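/- Let $\mathcal A$ be a finite alphabet and let $\theta:\mathcal A\to\mathcal A^*$ be a substitution, extended to words by concatenation. Let $X=X^\theta\subset\mathcal A^{\mathbb Z}$ be the set of all $x$ such that every finite subword of $x$ is a subword of $\theta^k(a)$ for some $k\ge 0$, $a\in\mathcal A$, and let $T:X\to X$ be the shift. A substitution $\theta$ is called primitive if for all $a,b$ there is $k\ge0$ such that $b$ occurs in $\theta^k(a)$, and $|\theta^k(a)|\to\infty$ for every $a$; it is proper if for some $k\ge 0$ and some letters $\ell,r$ every word $\theta^k(a)$ begins with $\ell$ and ends with $r$; it is aperiodic if $X^\theta$ contains no $T$-periodic point. Assume that $\theta$ is proper, primitive and aperiodic, and let $S:X\to X$ be a homeomorphism of the form $S(x)=T^{p(x)}(x)$ with $p:X\to\mathbb Z^+$ bounded. Labeling. For $k\ge 1$ and $i\in\mathcal A$ let $l_i(k)=|\theta^k(i)|$, and let $A_i(k)$ be the set of the $x\in X$ for which there are $y\in X$ and integers $(n_j)_{j\in\mathbb Z}$ with $n_0=0$, $y_0=i$ and $x[n_j,n_{j+1})=\theta^k(y_j)$, $n_{j+1}=n_j+|\theta^k(y_j)|$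 for all $j$. The sets $T^jA_i(k)$, $0\le j<l_i(k)$, are the floors of column $i$, and $j$ is the height of the floor. Call $k$ large if (1) $p$ is constant on every floor, (2) $l_i(k)>\max p$ for all $i$, and (3) $p$ is constant on $T^n\bigl(\bigcup_iA_i(k)\bigr)$ for $0\le n\le\max p$. In each column, labels $0,1,2,\dots$ are given to the floors successively: the lowest floor that has no label yet, say at height $s$, gets the next label $\ell$, and so does every floor of the same column at a height $j$ such that for some $n\ge0$ one has $s+\sum_{m=0}^{n-1}p(S^mx)=j$ for all $x\in T^sA_i(k)$. Let $c$ be the orbit number of $S$, i.e. the number such that every $T$-orbit is the union of exactly $c$ different $S$-orbits. For $\ell\in\{0,\dots,c-1\}$ let $\pi^{(k)}_i(\ell)$ be the label of the floor containing $S(x)$, for all $x$ in the highest floor of column $i$ with label $\ell$. Substitution. Let $K\ge1$ be such that $K$ is large and $\pi^{(jK)}_i=\pi^{(K)}_i=:\pi_i$ for all $i\in\mathcal A$ and $j\ge1$. Define the substitution $\sigma$ on the alphabet $\mathcal A\times\{0,\dots,c-1\}$ by $$\sigma(i,\ell)=(i_1,\ell_1)(i_2,\ell_2)\cdots(i_m,\ell_m),$$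 where $\theta^K(i)=i_1i_2\cdots i_m$, $\ell_1=\ell$ and $\ell_{r+1}=\pi_{i_r}(\ell_r)$ for $1\le r<m$. Then the orbit number $c\ge 1$ exists, a level $K$ with these properties exists, and for every such $K$ the substitution $\sigma$ is primitive if and only if $S$ is minimal, i.e. every $S$-orbit $\{S^jx:j\in\mathbb Z\}$ is dense in $X$. -/

import Mathlib

namespace Speedup

/-! ### Substitutions -/

section Substitutions

variable {A : Type*}

/-- The extension of `θ : A → A*` to words by concatenation. -/
def extend (θ : A → List A) (w : List A) : List A := w.flatMap θ

/-- The word `θ^k(a)`. -/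
def iter (θ : A → List A) (k : ℕ) (a : A) : List A := (extend θ)^[k] [a]

/-- The word `x[m, m + len)`. -/
def word (x : ℤ → A) (m : ℤ) (len : ℕ) : List A :=
  (List.range len).map fun i => x (m + (i : ℤ))

/-- The subshift `X^θ`: all finite words of `x` are subwords of some `θ^k(a)`. -/
def subshift (θ : A → List A) : Set (ℤ → A) :=
  {x | ∀ (m : ℤ) (len : ℕ), ∃ (k : ℕ) (a : A), word x m len <:+: iter θ k a}

structure IsPrimitive (θ : A → List A) : Prop where
  mem_iter : ∀ a b : A, ∃ k : ℕ, b ∈ iter θ k a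
  length_tendsto : ∀ a : A,
    Filter.Tendsto (fun k => (iter θ k a).length) Filter.atTop Filter.atTop

def IsProper (θ : A → List A) : Prop :=
  ∃ (l r : A) (k : ℕ), ∀ a : A,
    (iter θ k a).head? = some l ∧ (iter θ k a).getLast? = some r

theorem word_shift (x : ℤ → A) (d m : ℤ) (len : ℕ) :
    word (fun n => x (n + d)) m len = word x (m + d) len := by
  unfold word
  apply List.map_congr_left
  intro i _
  show x (m + i + d) = x (m + d + i)
  congr 1
  ring

theorem shift_mem {θ : A → List A} {x : ℤ → A} (hx : x ∈ subshift θ) (d : ℤ) :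
    (fun n => x (n + d)) ∈ subshift θ := by
  intro m len
  rw [word_shift]
  exact hx (m + d) len

/-- The shift `T` on `X^θ`, `(T x)(n) = x(n + 1)`. -/
def shift [TopologicalSpace A] (θ : A → List A) : subshift θ ≃ₜ subshift θ where
  toFun x := ⟨fun n => x.1 (n + 1), shift_mem x.2 1⟩
  invFun x := ⟨fun n => x.1 (n + (-1)), shift_mem x.2 (-1)⟩
  left_inv x := by ext n; simp
  right_inv x := by ext n; simp
  continuous_toFun := by
    apply Continuous.subtype_mk
    exact continuous_pi fun n => (continuous_apply (n + 1)).comp continuous_subtype_val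
  continuous_invFun := by
    apply Continuous.subtype_mk
    exact continuous_pi fun n => (continuous_apply (n + (-1))).comp continuous_subtype_val

/-- `θ` is aperiodic: `X^θ` contains no periodic point of the shift. -/
def IsAperiodic [TopologicalSpace A] (θ : A → List A) : Prop :=
  ∀ (x : subshift θ) (n : ℕ), 0 < n → (shift θ)^[n] x ≠ x

end Substitutions

/-! ### Homeomorphisms and bounded speedups -/

section Dynamics

variable {X : Type*} [TopologicalSpace X]

/-- The two-sided orbit `{f^j x : j ∈ ℤ}`. -/
def orbit (f : X ≃ₜ X) (x : X) : Set X := Set.range fun j : ℤ => (f ^ j) x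

/-- Every orbit is dense. -/
def IsMinimalHomeo (f : X ≃ₜ X) : Prop := ∀ x : X, Dense (orbit f x)

/-- `S` is a bounded speedup of `T` with jump function `p`. -/
structure IsBoundedSpeedup (T S : X ≃ₜ X) (p : X → ℕ) : Prop where
  pos : ∀ x, 0 < p x
  bounded : ∃ M : ℕ, ∀ x, p x ≤ M
  eq_iterate : ∀ x, S x = T^[p x] x

/-- Every `T`-orbit is the union of exactly `c` different `S`-orbits. -/
def IsOrbitNumber (T S : X ≃ₜ X) (c : ℕ) : Prop :=
  ∀ x : X, {O : Set X | (∃ y, O = orbit S y) ∧ O ⊆ orbit T x}.encard = (c : ℕ∞)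

/-- The maximal value of a bounded jump function. -/
noncomputable def maxJump (p : X → ℕ) : ℕ := sSup (Set.range p)

end Dynamics

/-! ### Kakutani-Rokhlin partitions and orbit block labelings -/

section Labeling

variable {A : Type*} [TopologicalSpace A] (θ : A → List A)

/-- `x` is decomposed into the `θ^k`-words `x[n_j, n_{j+1}) = θ^k(y_j)`, `j ∈ ℤ`. -/
def IsDecomposition (k : ℕ) (x y : ℤ → A) (n : ℤ → ℤ) : Prop :=
  ∀ j : ℤ, n (j + 1) = n j + ((iter θ k (y j)).length : ℤ) ∧
    word x (n j) (iter θ k (y j)).length = iter θ k (y j)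

/-- The base `A_i(k)` of the `i`-th column: the points `x` of `X^θ` whose decomposition into
`θ^k`-words has `n_0 = 0` and `x[n_0, n_1) = θ^k(i)`. As usual in the recognizability theory of
substitutions, the sequence of symbols of the decomposition is required to be in `X^θ`. -/
def base (k : ℕ) (i : A) : Set (subshift θ) :=
  {x | ∃ y ∈ subshift θ, ∃ n : ℤ → ℤ, IsDecomposition θ k x.1 y n ∧ n 0 = 0 ∧ y 0 = i}

/-- The number `l_i(k)` of floors of the `i`-th column. -/
def height (k : ℕ) (i : A) : ℕ := (iter θ k i).length

/-- The set `T^j A_i(k)`; it is a floor of the partition for `j < l_i(k)`. -/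
def floor (k : ℕ) (i : A) (j : ℕ) : Set (subshift θ) := (shift θ)^[j] '' base θ k i

variable (S : subshift θ ≃ₜ subshift θ) (p : subshift θ → ℕ)

/-- The three conditions that `k` is large enough for the labeling. -/
structure IsLarge (k : ℕ) : Prop where
  jump_const : ∀ (i : A) (j : ℕ), j < height θ k i →
    ∀ x ∈ floor θ k i j, ∀ y ∈ floor θ k i j, p x = p y
  tall : ∀ i : A, maxJump p < height θ k i
  low_floors : ∀ n ≤ maxJump p,
    ∀ x ∈ (shift θ)^[n] '' (⋃ i, base θ k i), ∀ y ∈ (shift θ)^[n] '' (⋃ i, base θ k i), p x = p y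

/-- The `S`-path which starts on floor `s` of column `i` climbs from floor `s` to floor `j`:
for some `n`, every `x` in floor `s` has `S^n x = T^(j - s) x` with
`j - s = p(x) + p(S x) + ⋯ + p(S^(n-1) x)`. -/
def Climbs (k : ℕ) (i : A) (s j : ℕ) : Prop :=
  ∃ n : ℕ, ∀ x ∈ floor θ k i s, s + ∑ m ∈ Finset.range n, p (S^[m] x) = j

/-- `HasLabel θ S p k i ℓ j`: floor `j` of column `i` gets the label `ℓ`. The lowest floor `s` of
the column without a label `< ℓ` gets the label `ℓ`, and so do the floors of the column that the
`S`-path from floor `s` climbs to. -/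
def HasLabel (k : ℕ) (i : A) (ℓ j : ℕ) : Prop :=
  ∃ s : ℕ, IsLeast {t : ℕ | t < height θ k i ∧ ∀ m, ∀ _ : m < ℓ, ¬ HasLabel k i m t} s ∧
    j < height θ k i ∧ Climbs θ S p k i s j
termination_by ℓ

/-- The floor that contains `x` has the label `ℓ`. -/
def PointHasLabel (k : ℕ) (x : subshift θ) (ℓ : ℕ) : Prop :=
  ∃ (i : A) (j : ℕ), x ∈ floor θ k i j ∧ HasLabel θ S p k i ℓ j

/-- `π` is the tuple `π^(k)`: for all `x` in the highest floor of column `i` with label `ℓ`,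
the label of the floor that contains `S x` is `π_i(ℓ)`. -/
def IsLabelMap {c : ℕ} (k : ℕ) (π : A → Fin c → Fin c) : Prop :=
  ∀ (i : A) (ℓ : Fin c) (j : ℕ), IsGreatest {t : ℕ | HasLabel θ S p k i ℓ t} j →
    ∀ x ∈ floor θ k i j, PointHasLabel θ S p k (S x) (π i ℓ)

/-- The level `K` is large, and `π = π^(K) = π^(2K) = π^(3K) = ⋯`. -/
structure IsStableLevel {c : ℕ} (K : ℕ) (π : A → Fin c → Fin c) : Prop where
  pos : 0 < K
  large : IsLarge θ p K
  labelMap : ∀ j : ℕ, 1 ≤ j → IsLabelMap θ S p (j * K) π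

end Labeling

/-! ### The symbol-label substitution -/

section SymbolLabel

variable {A C : Type*}

/-- `(i_1, ℓ_1)(i_2, ℓ_2)⋯(i_m, ℓ_m)` with `ℓ_1 = ℓ` and `ℓ_{r+1} = π_{i_r}(ℓ_r)`. -/
def labelWord (π : A → C → C) : C → List A → List (A × C)
  | _, [] => []
  | ℓ, i :: w => (i, ℓ) :: labelWord π (π i ℓ) w

/-- The substitution `σ` on `A × C` built from `θ^K` and `π`. -/
def symbolLabel (θ : A → List A) (K : ℕ) (π : A → C → C) : A × C → List (A × C) :=
  fun q => labelWord π q.2 (iter θ K q.1)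

end SymbolLabel

end Speedup

/-! By Mossé's recognizability theorem the floors of level `k` form a clopen partition of `X`. Every
`S`-path that enters a column does so on one of the lowest `max p` floors, and by the choice of `K`
all columns have the same entry heights `e_0 < ⋯ < e_(c-1)`. So the `S`-orbits in a `T`-orbit
correspond to the entry points of any column, the path that enters at height `e_ℓ` carries the
label `ℓ`, and `π_i` tells where the paths through column `i` enter the next one. Hence `(i', ℓ')`
occurs in `σ^n(i, ℓ)` if and only if the path that enters column `i` of level `(n + 1) K` with
label `ℓ` enters, on its way up, a copy of column `i'` of level `K` with label `ℓ'`. If `S` is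
minimal, bounded return times to the floor of height `e_ℓ'` force this for large `n`. Conversely, if
it always happens for some `n`, then, since `π` is the same at the levels `jK`, every path visits
every floor of every level `jK`; as properness makes the floors shrink to points, all `S`-orbits
are dense. -/

namespace Speedup

section Iterates

variable {A : Type*} {θ : A → List A}

theorem extend_iterate_append (θ : A → List A) (k : ℕ) (u v : List A) :
    (extend θ)^[k] (u ++ v) = (extend θ)^[k] u ++ (extend θ)^[k] v := by
  induction k generalizing u v with
  | zero => rfl
  | succ k ih => simp only [Function.iterate_succ_apply, extend, List.flatMap_append, ← ih]

theorem extend_iterate (θ : A → List A) (k : ℕ) (w : List A) :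
    (extend θ)^[k] w = w.flatMap (iter θ k) := by
  induction w with
  | nil => exact Function.iterate_fixed rfl k
  | cons a w ih =>
    rw [List.flatMap_cons, ← ih, ← List.singleton_append, extend_iterate_append]
    rfl

theorem iter_add (θ : A → List A) (k m : ℕ) (a : A) :
    iter θ (k + m) a = (iter θ m a).flatMap (iter θ k) := by
  rw [← extend_iterate]
  exact Function.iterate_add_apply _ _ _ _

/-- Non-erasing substitutions: no letter is mapped to the empty word. -/
def IsNonerasing (θ : A → List A) : Prop := ∀ a, θ a ≠ []

/-- Uniform primitivity: all letters occur in all words `θ^n(a)` of sufficiently high level `n`.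
Under `IsPrimitive` the letter `b` may occur in `θ^n(a)` for the `n` of one residue class only;
conversely, `IsUniformlyPrimitive` does not make the words grow if there is a single letter. -/
def IsUniformlyPrimitive (θ : A → List A) : Prop :=
  ∃ n₀, ∀ n ≥ n₀, ∀ a b, b ∈ iter θ n a

theorem IsNonerasing.iter_ne_nil (hθ : IsNonerasing θ) (k : ℕ) (a : A) : iter θ k a ≠ [] := by
  induction k with
  | zero => exact List.cons_ne_nil a []
  | succ k ih =>
    obtain ⟨b, hb⟩ := List.exists_mem_of_ne_nil _ ih
    rw [add_comm, iter_add]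
    exact fun h => hθ b ((List.append_eq_nil_iff.1 (List.flatMap_eq_nil_iff.1 h b hb)).1)

theorem IsNonerasing.length_pos (hθ : IsNonerasing θ) (k : ℕ) (a : A) :
    0 < (iter θ k a).length :=
  List.length_pos_iff.2 (hθ.iter_ne_nil k a)

theorem isNonerasing_of_frequently_iter_ne_nil
    (h : ∀ (a : A) (k : ℕ), ∃ n ≥ k, iter θ n a ≠ []) : IsNonerasing θ := by
  intro a ha
  obtain ⟨n, hn, hne⟩ := h a 1
  obtain ⟨m, rfl⟩ := Nat.exists_eq_add_of_le' hn
  exact hne (by rw [iter_add]; simp [iter, extend, ha])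

theorem IsPrimitive.isNonerasing (hθ : IsPrimitive θ) : IsNonerasing θ := by
  refine isNonerasing_of_frequently_iter_ne_nil fun a k => ?_
  obtain ⟨n, hlen, hn⟩ := (((hθ.length_tendsto a).eventually_ge_atTop 1).and
    (Filter.eventually_ge_atTop k)).exists
  exact ⟨n, hn, List.length_pos_iff.1 hlen⟩

theorem IsUniformlyPrimitive.isNonerasing (hθ : IsUniformlyPrimitive θ) : IsNonerasing θ := by
  obtain ⟨n₀, h⟩ := hθ
  exact isNonerasing_of_frequently_iter_ne_nil fun a k =>
    ⟨max k n₀, le_max_left _ _, List.ne_nil_of_mem (h _ (le_max_right _ _) a a)⟩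

theorem isUniformlyPrimitive_of_forall_mem_iter [Finite A]
    (hirr : ∀ a b : A, ∃ k : ℕ, b ∈ iter θ k a) (f : A → A) (n₀ : ℕ)
    (hf : ∀ n ≥ n₀, ∀ a, f a ∈ iter θ n a) : IsUniformlyPrimitive θ := by
  choose k hk using hirr
  obtain ⟨N, hN⟩ := (Set.finite_range fun q : A × A => k q.1 q.2).bddAbove
  refine ⟨n₀ + N, fun n hn a b => ?_⟩
  have hle : k (f a) b ≤ N := hN ⟨(f a, b), rfl⟩
  obtain ⟨m, rfl⟩ := Nat.exists_eq_add_of_le (show k (f a) b ≤ n by omega)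
  rw [iter_add, List.mem_flatMap]
  exact ⟨f a, hf m (by omega) a, hk _ _⟩

theorem IsNonerasing.head?_iter (hθ : IsNonerasing θ) {l : A} {k : ℕ}
    (hl : ∀ a, (iter θ k a).head? = some l) {n : ℕ} (hn : k ≤ n) (a : A) :
    (iter θ n a).head? = some l := by
  obtain ⟨m, rfl⟩ := Nat.exists_eq_add_of_le hn
  obtain ⟨b, w, hw⟩ := List.exists_cons_of_ne_nil (hθ.iter_ne_nil m a)
  simp [iter_add, hw, List.head?_append, hl b]

theorem IsPrimitive.isUniformlyPrimitive [Finite A] (hθ : IsPrimitive θ) (hp : IsProper θ) :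
    IsUniformlyPrimitive θ := by
  obtain ⟨l, _, k, hlr⟩ := hp
  exact isUniformlyPrimitive_of_forall_mem_iter hθ.mem_iter (fun _ => l) k fun n hn a =>
    List.mem_of_mem_head? (hθ.isNonerasing.head?_iter (fun a => (hlr a).1) hn a)

theorem exists_length_iter_le [Finite A] (θ : A → List A) (k : ℕ) :
    ∃ M, ∀ a, (iter θ k a).length ≤ M := by
  obtain ⟨M, hM⟩ := (Set.finite_range fun a => (iter θ k a).length).bddAbove
  exact ⟨M, fun a => hM ⟨a, rfl⟩⟩

end Iterates

section Concatenation

variable {A B : Type*}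

theorem length_flatMap_le {f : A → List B} {M : ℕ} (hf : ∀ a, (f a).length ≤ M) (w : List A) :
    (w.flatMap f).length ≤ w.length * M := by
  induction w with
  | nil => simp
  | cons a w ih =>
    have := hf a
    simp only [List.flatMap_cons, List.length_append, List.length_cons, add_mul]
    omega

theorem le_length_flatMap {f : A → List B} {μ : ℕ} (hf : ∀ a, μ ≤ (f a).length) (w : List A) :
    w.length * μ ≤ (w.flatMap f).length := by
  induction w with
  | nil => simp
  | cons a w ih =>
    have := hf a
    simp only [List.flatMap_cons, List.length_append, List.length_cons, add_mul]
    omega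

theorem flatMap_infix_flatMap (f : A → List B) {v w : List A} (h : v <:+: w) :
    v.flatMap f <:+: w.flatMap f := by
  obtain ⟨s, t, rfl⟩ := h
  exact ⟨s.flatMap f, t.flatMap f, by simp⟩

theorem infix_flatMap_of_mem (f : A → List B) {w : List A} {a : A} (ha : a ∈ w) :
    f a <:+: w.flatMap f := by
  obtain ⟨s, t, rfl⟩ := List.append_of_mem ha
  exact ⟨s.flatMap f, t.flatMap f, by simp⟩

theorem exists_split_flatMap {f : A → List B} {w : List A} {j : ℕ}
    (hj : j < (w.flatMap f).length) :
    ∃ u b v, w = u ++ b :: v ∧ (u.flatMap f).length ≤ j ∧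
      j < (u.flatMap f).length + (f b).length := by
  induction w generalizing j with
  | nil => simp at hj
  | cons a w ih =>
    by_cases h : j < (f a).length
    · exact ⟨[], a, w, rfl, by simp, by simpa using h⟩
    · rw [List.flatMap_cons, List.length_append] at hj
      obtain ⟨u, b, v, rfl, h1, h2⟩ := ih (j := j - (f a).length) (by omega)
      refine ⟨a :: u, b, v, rfl, ?_, ?_⟩ <;>
        simp only [List.flatMap_cons, List.length_append] <;> omega

theorem infix_of_append_eq_append {s u t s' u' t' : List A} (h : s ++ u ++ t = s' ++ u' ++ t')
    (hs : s.length ≤ s'.length) (hu : s'.length + u'.length ≤ s.length + u.length) :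
    u' <:+: u := by
  rw [List.append_assoc, List.append_assoc] at h
  obtain ⟨d, rfl, h'⟩ : ∃ d, s' = s ++ d ∧ u ++ t = d ++ (u' ++ t') := by
    rcases List.append_eq_append_iff.1 h with hd | ⟨d, rfl, hd⟩
    · exact hd
    · obtain rfl : d = [] := List.length_eq_zero_iff.1 (by simpa using hs)
      exact ⟨[], by simp, by simpa using hd.symm⟩
  have hpre : d ++ u' <+: u := by
    refine List.prefix_of_prefix_length_le (l₃ := u ++ t) ⟨t', by simp [h']⟩
      (List.prefix_append u t) ?_
    simp only [List.length_append] at hu ⊢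
    omega
  exact (List.suffix_append d u').isInfix.trans hpre.isInfix

theorem exists_infix_of_infix_flatMap {f : A → List B} {M : ℕ} (hf : ∀ a, (f a).length ≤ M)
    {u : List B} (hu : 2 * M < u.length) {v : List A} (h : u <:+: v.flatMap f) :
    ∃ b ∈ v, f b <:+: u := by
  obtain ⟨s, t, h⟩ := h
  have hlen := congrArg List.length h
  simp only [List.length_append] at hlen
  obtain ⟨v₁, a, v₂, rfl, h1, h2⟩ := exists_split_flatMap (f := f) (w := v) (j := s.length)
    (by omega)
  have ha := hf a
  cases v₂ with
  | nil =>
    simp only [List.flatMap_append, List.flatMap_cons, List.flatMap_nil, List.length_append,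
      List.length_nil] at hlen
    omega
  | cons b v₂ =>
    have hb := hf b
    refine ⟨b, by simp, infix_of_append_eq_append (s' := v₁.flatMap f ++ f a)
      (t' := v₂.flatMap f) (h.trans (by simp)) ?_ ?_⟩ <;>
      simp only [List.length_append] <;> omega

end Concatenation

section Words

variable {A : Type*} {θ : A → List A}

/- In the definition of `word` the coercion is applied to the list `List.range len` and not to its
entries. -/
theorem word_eq_map (x : ℤ → A) (m : ℤ) (len : ℕ) :
    word x m len = (List.range len).map fun i : ℕ => x (m + i) := by
  have hcoe (l : List ℕ) : (do let a ← l; pure (a : ℤ) : List ℤ) = l.map fun i : ℕ => (i : ℤ) := by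
    induction l <;> simp_all
  rw [word, hcoe, List.map_map]
  rfl

@[simp]
theorem length_word (x : ℤ → A) (m : ℤ) (len : ℕ) : (word x m len).length = len := by
  simp [word_eq_map]

@[simp]
theorem getElem_word (x : ℤ → A) (m : ℤ) (len i : ℕ) (h : i < (word x m len).length) :
    (word x m len)[i] = x (m + i) := by
  simp [word_eq_map]

@[simp]
theorem word_zero (x : ℤ → A) (m : ℤ) : word x m 0 = [] := by
  simp [word_eq_map]

@[simp]
theorem word_one (x : ℤ → A) (m : ℤ) : word x m 1 = [x m] := by
  simp [word_eq_map]

theorem word_add (x : ℤ → A) (m : ℤ) (a b : ℕ) :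
    word x m (a + b) = word x m a ++ word x (m + a) b := by
  simp [word_eq_map, List.range_add, add_assoc]

theorem word_eq_word_iff {x y : ℤ → A} {m m' : ℤ} {len : ℕ} :
    word x m len = word y m' len ↔ ∀ i : ℕ, i < len → x (m + i) = y (m' + i) := by
  simp [word_eq_map]

theorem apply_eq_of_word_eq {x y : ℤ → A} {m m' : ℤ} {len : ℕ}
    (h : word x m len = word y m' len) {i : ℤ} (h1 : m ≤ i) (h2 : i < m + len) :
    x i = y (m' + (i - m)) := by
  obtain ⟨j, hj⟩ := Int.eq_ofNat_of_zero_le (sub_nonneg.2 h1)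
  obtain rfl : i = m + j := by omega
  rw [word_eq_word_iff.1 h j (by omega), add_sub_cancel_left]

theorem word_prefix_of_word_eq_append {x : ℤ → A} {m : ℤ} {len : ℕ} {u v : List A}
    (h : word x m len = u ++ v) : word x m u.length = u := by
  have hlen := congrArg List.length h
  simp only [length_word, List.length_append] at hlen
  rw [hlen, word_add] at h
  exact (List.append_inj h (by simp)).1

theorem word_suffix_of_word_eq_append {x : ℤ → A} {m : ℤ} {len : ℕ} {u v : List A}
    (h : word x m len = u ++ v) : word x (m + u.length) v.length = v := by
  have hlen := congrArg List.length h
  simp only [length_word, List.length_append] at hlen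
  rw [hlen, word_add] at h
  exact (List.append_inj h (by simp)).2

theorem word_infix_word (x : ℤ → A) {m m' : ℤ} {len len' : ℕ} (h₁ : m ≤ m')
    (h₂ : m' + len' ≤ m + len) : word x m' len' <:+: word x m len := by
  obtain ⟨a, ha⟩ := Int.eq_ofNat_of_zero_le (sub_nonneg.2 h₁)
  obtain ⟨b, hb⟩ := Int.eq_ofNat_of_zero_le (sub_nonneg.2 h₂)
  obtain rfl : m' = m + a := by omega
  obtain rfl : len = a + len' + b := by omega
  rw [word_add, word_add]
  exact ⟨_, _, rfl⟩

theorem exists_word_eq_of_infix {x : ℤ → A} {m : ℤ} {len : ℕ} {w : List A}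
    (h : w <:+: word x m len) :
    ∃ i : ℤ, m ≤ i ∧ i + w.length ≤ m + len ∧ word x i w.length = w := by
  obtain ⟨s, t, h⟩ := h
  have hlen := congrArg List.length h
  simp only [length_word, List.length_append] at hlen
  exact ⟨m + s.length, by omega, by omega,
    word_suffix_of_word_eq_append (word_prefix_of_word_eq_append h.symm)⟩

end Words

section Language

variable {A : Type*} {θ : A → List A}

/-- The language of `θ`: the subwords of the words `θ^k(a)`. -/
def language (θ : A → List A) : Set (List A) := {w | ∃ (k : ℕ) (a : A), w <:+: iter θ k a}

theorem word_mem_language {x : ℤ → A} (hx : x ∈ subshift θ) (m : ℤ) (len : ℕ) :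
    word x m len ∈ language θ := hx m len

theorem mem_language_of_infix {v w : List A} (hw : w ∈ language θ) (h : v <:+: w) :
    v ∈ language θ := by
  obtain ⟨k, a, hw⟩ := hw
  exact ⟨k, a, h.trans hw⟩

theorem singleton_mem_language (θ : A → List A) (a : A) : [a] ∈ language θ :=
  ⟨0, a, List.infix_rfl⟩

theorem flatMap_iter_mem_language {w : List A} (hw : w ∈ language θ) (k : ℕ) :
    w.flatMap (iter θ k) ∈ language θ := by
  obtain ⟨j, a, h⟩ := hw
  exact ⟨k + j, a, by rw [iter_add]; exact flatMap_infix_flatMap _ h⟩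

/-- A long word of the language contains one of the words `θ^(k + n)(b)`, which all contain
`θ^k(a)`. -/
theorem exists_window [Finite A] (hθ : IsUniformlyPrimitive θ) {w : List A}
    (hw : w ∈ language θ) : ∃ ρ : ℕ, ∀ x ∈ subshift θ, ∀ m : ℤ,
      ∃ i : ℤ, m ≤ i ∧ i + w.length ≤ m + ρ ∧ word x i w.length = w := by
  obtain ⟨k, a, hw⟩ := hw
  obtain ⟨n, hn⟩ := hθ
  obtain ⟨M, hM⟩ := exists_length_iter_le θ (k + n)
  refine ⟨2 * M + 1, fun x hx m => exists_word_eq_of_infix ?_⟩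
  obtain ⟨j, b, hj⟩ := hx m (2 * M + 1)
  have hlevel : word x m (2 * M + 1) <:+: (iter θ j b).flatMap (iter θ (k + n)) := by
    refine hj.trans ?_
    rw [← iter_add, add_comm, iter_add]
    exact infix_flatMap_of_mem _ (hn _ (by omega) _ _)
  obtain ⟨d, -, hd⟩ := exists_infix_of_infix_flatMap hM (by simp) hlevel
  rw [iter_add] at hd
  exact (hw.trans (infix_flatMap_of_mem _ (hn _ le_rfl _ _))).trans hd

theorem exists_apply_eq [Finite A] (hθ : IsUniformlyPrimitive θ) {x : ℤ → A}
    (hx : x ∈ subshift θ) (a : A) : ∃ i : ℤ, x i = a := by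
  obtain ⟨ρ, hρ⟩ := exists_window hθ (singleton_mem_language θ a)
  obtain ⟨i, -, -, hi⟩ := hρ x hx 0
  exact ⟨i, by simpa using hi⟩

/-- Every word of length `len` of `z` occurs in every word of length `ρ` of `z`, that is, `ρ` is at
least the value at `len` of the recurrence function of `z`. -/
def IsRecurrenceBound (z : ℤ → A) (len ρ : ℕ) : Prop :=
  ∀ t m : ℤ, ∃ i : ℤ, m ≤ i ∧ i + len ≤ m + ρ ∧ word z i len = word z t len

theorem exists_isRecurrenceBound [Finite A] (hθ : IsUniformlyPrimitive θ) (len : ℕ) :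
    ∃ ρ : ℕ, ∀ z ∈ subshift θ, IsRecurrenceBound z len ρ := by
  choose ρ hρ using fun w : language θ => exists_window hθ w.2
  have hfin : {w : language θ | w.1.length = len}.Finite :=
    (List.finite_length_eq A len).preimage Subtype.val_injective.injOn
  obtain ⟨N, hN⟩ := (hfin.image ρ).bddAbove
  refine ⟨N, fun z hz t m => ?_⟩
  obtain ⟨i, h1, h2, h3⟩ := hρ ⟨_, word_mem_language hz t len⟩ z hz m
  have hle : ρ ⟨_, word_mem_language hz t len⟩ ≤ N := hN ⟨_, by simp, rfl⟩
  simp only [length_word] at h2 h3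
  exact ⟨i, h1, by omega, h3⟩

end Language

section Compactness

variable {A : Type*} {θ : A → List A}

theorem isClopen_setOf_word [TopologicalSpace A] [DiscreteTopology A] (P : List A → Prop) (m : ℤ)
    (len : ℕ) : IsClopen {x : ℤ → A | P (word x m len)} := by
  have hcont : Continuous fun (x : ℤ → A) (i : Fin len) => x (m + (i : ℕ)) :=
    continuous_pi fun i => continuous_apply _
  have hword (x : ℤ → A) : word x m len = List.ofFn fun i : Fin len => x (m + (i : ℕ)) := by
    apply List.ext_getElem <;> simp
  simp only [hword]
  exact (isClopen_discrete {f | P (List.ofFn f)}).preimage hcont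

theorem isClosed_subshift [TopologicalSpace A] [DiscreteTopology A] (θ : A → List A) :
    IsClosed (subshift θ) := by
  simp only [subshift, Set.ofPred_forall]
  exact isClosed_iInter fun m => isClosed_iInter fun len =>
    (isClopen_setOf_word (· ∈ language θ) m len).isClosed

theorem compactSpace_subshift [Finite A] [TopologicalSpace A] [DiscreteTopology A]
    (θ : A → List A) : CompactSpace (subshift θ) :=
  isCompact_iff_compactSpace.1 (isClosed_subshift θ).isCompact

theorem exists_word_eq_of_length_eq [Nonempty A] (m : ℤ) (w : List A) :
    ∃ x : ℤ → A, word x m w.length = w := by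
  obtain ⟨a⟩ := ‹Nonempty A›
  refine ⟨fun i => w.getD (i - m).toNat a, List.ext_getElem (by simp) fun i _ hi => ?_⟩
  simp [hi]

theorem subshift_nonempty [Finite A] (hlong : ∀ n, ∃ w ∈ language θ, n ≤ w.length) :
    (subshift θ).Nonempty := by
  let _ : TopologicalSpace A := ⊥
  have : DiscreteTopology A := ⟨rfl⟩
  let F (n : ℕ) : Set (ℤ → A) := {x | word x (-n) (2 * n) ∈ language θ}
  have hclosed (n : ℕ) : IsClosed (F n) :=
    (isClopen_setOf_word (· ∈ language θ) (-n) (2 * n)).isClosed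
  have hanti (n : ℕ) : F (n + 1) ⊆ F n := fun x hx =>
    mem_language_of_infix hx (word_infix_word x (by omega) (by push_cast; omega))
  have hne (n : ℕ) : (F n).Nonempty := by
    obtain ⟨w, hw, hlen⟩ := hlong (2 * n)
    have : Nonempty A := ⟨hw.choose_spec.choose⟩
    obtain ⟨x, hx⟩ := exists_word_eq_of_length_eq (-(n : ℤ)) (w.take (2 * n))
    rw [List.length_take_of_le hlen] at hx
    exact ⟨x, mem_language_of_infix hw (hx ▸ (List.take_prefix _ _).isInfix)⟩
  obtain ⟨x, hx⟩ := IsCompact.nonempty_iInter_of_sequence_nonempty_isCompact_isClosed F hanti hne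
    (hclosed 0).isCompact hclosed
  refine ⟨x, fun m len => ?_⟩
  refine mem_language_of_infix (Set.mem_iInter.1 hx (m.natAbs + len))
    (word_infix_word x ?_ ?_) <;> push_cast <;> rcases abs_cases m with h | h <;> omega

theorem IsPrimitive.subshift_nonempty [Finite A] [Nonempty A] (hθ : IsPrimitive θ) :
    (subshift θ).Nonempty := by
  obtain ⟨a⟩ := ‹Nonempty A›
  refine Speedup.subshift_nonempty fun n => ?_
  obtain ⟨k, hk⟩ := ((hθ.length_tendsto a).eventually_ge_atTop n).exists
  exact ⟨_, ⟨k, a, List.infix_rfl⟩, hk⟩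

end Compactness

section IntegerSequences

theorem exists_add_one_eq_add (f : ℤ → ℤ) :
    ∃ n : ℤ → ℤ, n 0 = 0 ∧ ∀ j, n (j + 1) = n j + f j := by
  refine ⟨fun j => ∑ i ∈ Finset.Ico 0 j, f i - ∑ i ∈ Finset.Ico j 0, f i, by simp, fun j => ?_⟩
  rcases le_or_gt 0 j with hj | hj
  · have h : Finset.Ico 0 (j + 1) = insert j (Finset.Ico 0 j) := by
      ext i; simp only [Finset.mem_Ico, Finset.mem_insert]; omega
    simp [h, Finset.Ico_eq_empty_of_le hj,
      Finset.Ico_eq_empty_of_le (hj.trans (Int.le_add_one le_rfl)), add_comm]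
  · have h : Finset.Ico j 0 = insert j (Finset.Ico (j + 1) 0) := by
      ext i; simp only [Finset.mem_Ico, Finset.mem_insert]; omega
    simp [h, Finset.Ico_eq_empty_of_le hj.le, Finset.Ico_eq_empty_of_le (Int.add_one_le_of_lt hj)]

variable {n : ℤ → ℤ}

theorem add_le_apply_add (hn : StrictMono n) (a : ℤ) (m : ℕ) : n a + m ≤ n (a + m) := by
  induction m with
  | zero => simp
  | succ m ih =>
    have := hn (show a + m < a + (m + 1 : ℕ) by omega)
    push_cast at *
    omega

theorem exists_le_lt_succ (hn : StrictMono n) (i : ℤ) : ∃ j, n j ≤ i ∧ i < n (j + 1) := by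
  obtain ⟨j, hj, hmax⟩ := Int.exists_greatest_of_bdd (P := fun j => n j ≤ i)
    ⟨(i - n 0).natAbs, fun z hz => by
      by_contra! h
      have h1 := add_le_apply_add hn 0 (i - n 0).natAbs
      have h2 := hn h
      rw [zero_add] at h1
      omega⟩
    ⟨-(i - n 0).natAbs, by
      have h1 := add_le_apply_add hn (-(i - n 0).natAbs) (i - n 0).natAbs
      rw [neg_add_cancel] at h1
      omega⟩
  exact ⟨j, hj, not_le.1 fun h => by have := hmax _ h; omega⟩

end IntegerSequences

section Decompositions

variable {A : Type*} {θ : A → List A} {k m : ℕ} {x y x' y' z : ℤ → A} {n n' b : ℤ → ℤ}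

theorem IsDecomposition.strictMono (hθ : IsNonerasing θ) (h : IsDecomposition θ k x y n) :
    StrictMono n :=
  strictMono_int_of_lt_succ fun j => by
    have := hθ.length_pos k (y j)
    rw [(h j).1]
    omega

theorem IsDecomposition.word_flatMap (h : IsDecomposition θ k x y n) (a : ℤ) (len : ℕ) :
    n (a + len) = n a + ((word y a len).flatMap (iter θ k)).length ∧
      word x (n a) ((word y a len).flatMap (iter θ k)).length
        = (word y a len).flatMap (iter θ k) := by
  induction len with
  | zero => simp
  | succ len ih =>
    rw [word_add, word_one, List.flatMap_append, List.flatMap_singleton, List.length_append,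
      word_add, ih.2, ← ih.1, (h _).2]
    refine ⟨?_, rfl⟩
    push_cast
    rw [← add_assoc, (h _).1, ih.1, add_assoc]

theorem IsDecomposition.shift (h : IsDecomposition θ k x y n) (d e : ℤ) :
    IsDecomposition θ k (fun i => x (i + d)) (fun i => y (i + e)) fun j => n (j + e) - d := by
  intro j
  obtain ⟨h1, h2⟩ := h (j + e)
  constructor
  · simp only [add_right_comm j 1 e, h1]
    ring
  · rw [word_shift]
    simpa using h2

theorem exists_decomposition (hθ : IsNonerasing θ) (k : ℕ) (y : ℤ → A) :
    ∃ x n, IsDecomposition θ k x y n ∧ n 0 = 0 := by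
  obtain ⟨n, h0, hn⟩ := exists_add_one_eq_add fun j => ((iter θ k (y j)).length : ℤ)
  have hmono : StrictMono n := strictMono_int_of_lt_succ fun j => by
    have := hθ.length_pos k (y j)
    rw [hn]
    omega
  choose idx hidx using exists_le_lt_succ hmono
  refine ⟨fun i => (iter θ k (y (idx i))).getD (i - n (idx i)).toNat (y 0), n,
    fun j => ⟨hn j, List.ext_getElem (by simp) fun i _ h₂ => ?_⟩, h0⟩
  have hj : idx (n j + i) = j := by
    obtain ⟨h3, h4⟩ := hidx (n j + i)
    have h5 : j < idx (n j + i) + 1 := hmono.lt_iff_lt.1 (by omega)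
    have h6 : idx (n j + i) < j + 1 := hmono.lt_iff_lt.1 (by rw [hn j]; omega)
    omega
  simp [hj, h₂]

theorem IsDecomposition.comp (hy : IsDecomposition θ m y z b) (hx : IsDecomposition θ k x y n) :
    IsDecomposition θ (k + m) x z (n ∘ b) := by
  intro j
  obtain ⟨h1, h2⟩ := hy j
  obtain ⟨h3, h4⟩ := hx.word_flatMap (b j) (iter θ m (z j)).length
  rw [h2] at h3 h4
  rw [iter_add]
  exact ⟨by simp only [Function.comp, h1, h3], h4⟩

theorem IsDecomposition.sub_eq_sub_of_word_eq (h : IsDecomposition θ k x y n)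
    (h' : IsDecomposition θ k x' y' n') {a a' : ℤ} {len : ℕ} (hw : word y a len = word y' a' len) :
    n (a + len) - n a = n' (a' + len) - n' a' := by
  rw [(h.word_flatMap a len).1, (h'.word_flatMap a' len).1, hw]
  ring

theorem IsDecomposition.apply_eq_of_word_eq (h : IsDecomposition θ k x y n)
    (h' : IsDecomposition θ k x' y' n') {a a' : ℤ} {len : ℕ} (hw : word y a len = word y' a' len)
    {i : ℤ} (hi : n a ≤ i) (hi' : i < n (a + len)) : x i = x' (n' a' + (i - n a)) := by
  obtain ⟨h1, h2⟩ := h.word_flatMap a len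
  obtain ⟨-, h3⟩ := h'.word_flatMap a' len
  rw [← hw] at h3
  exact Speedup.apply_eq_of_word_eq (h2.trans h3.symm) hi (by omega)

theorem word_eq_of_eqOn {I : Set ℤ} (hy : Set.EqOn y y' I) {a : ℤ} {len : ℕ}
    (hI : Set.Ico a (a + len) ⊆ I) : word y a len = word y' a len :=
  word_eq_word_iff.2 fun i hi => hy (hI ⟨by omega, by omega⟩)

theorem IsDecomposition.eqOn_cuts (h : IsDecomposition θ k x y n)
    (h' : IsDecomposition θ k x' y' n') (h0 : n 0 = n' 0) {N : ℤ}
    (hy : Set.EqOn y y' (Set.Ico (-N) N)) : Set.EqOn n n' (Set.Icc (-N) N) := by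
  rintro i ⟨h1, h2⟩
  obtain ⟨d, rfl | rfl⟩ := Int.eq_nat_or_neg i
  · have := h.sub_eq_sub_of_word_eq h' (word_eq_of_eqOn hy (a := 0) (len := d)
      (Set.Ico_subset_Ico (by omega) (by omega)))
    simp only [zero_add] at this
    omega
  · have := h.sub_eq_sub_of_word_eq h' (word_eq_of_eqOn hy (a := -d) (len := d)
      (Set.Ico_subset_Ico (by omega) (by omega)))
    simp only [neg_add_cancel] at this
    omega

theorem IsDecomposition.eqOn (hθ : IsNonerasing θ) (h : IsDecomposition θ k x y n)
    (h' : IsDecomposition θ k x' y' n') (h0 : n 0 = n' 0) {N : ℕ}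
    (hy : Set.EqOn y y' (Set.Ico (-N) N)) : Set.EqOn x x' (Set.Ico (n 0 - N) (n 0 + N)) := by
  rintro i ⟨h1, h2⟩
  have hcut : n (-N) = n' (-N) := h.eqOn_cuts h' h0 hy ⟨le_rfl, by omega⟩
  have hleft := add_le_apply_add (h.strictMono hθ) (-N) N
  have hright := add_le_apply_add (h.strictMono hθ) 0 N
  rw [neg_add_cancel] at hleft
  rw [zero_add] at hright
  have := h.apply_eq_of_word_eq h' (len := 2 * N) (i := i)
    (word_eq_of_eqOn hy (Set.Ico_subset_Ico_right (by push_cast; omega))) (by omega)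
    (by rw [show -(N : ℤ) + (2 * N : ℕ) = N by push_cast; ring]; omega)
  rwa [← hcut, add_sub_cancel] at this

theorem IsDecomposition.unique (hθ : IsNonerasing θ) (h : IsDecomposition θ k x y n)
    (h' : IsDecomposition θ k x' y n') (h0 : n 0 = n' 0) : n = n' ∧ x = x' :=
  ⟨funext fun i => h.eqOn_cuts h' h0 (N := i.natAbs) (Set.eqOn_refl y _) ⟨by omega, by omega⟩,
    funext fun i => h.eqOn hθ h' h0 (N := (i - n 0).natAbs + 1) (Set.eqOn_refl y _)
      ⟨by omega, by omega⟩⟩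

theorem IsDecomposition.mem_subshift (hθ : IsNonerasing θ) (h : IsDecomposition θ k x y n)
    (hy : y ∈ subshift θ) : x ∈ subshift θ := by
  intro m len
  have hmono := h.strictMono hθ
  obtain ⟨j, hj, -⟩ := exists_le_lt_succ hmono m
  obtain ⟨j', -, hj'⟩ := exists_le_lt_succ hmono (m + len)
  have hjj : j < j' + 1 := hmono.lt_iff_lt.1 (by omega)
  obtain ⟨d, hd⟩ := Int.eq_ofNat_of_zero_le (sub_nonneg.2 hjj.le)
  obtain ⟨h1, h2⟩ := h.word_flatMap j d
  rw [show j + (d : ℤ) = j' + 1 by omega] at h1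
  refine mem_language_of_infix (flatMap_iter_mem_language (word_mem_language hy j d) k) ?_
  rw [← h2]
  exact word_infix_word x hj (by omega)

theorem IsDecomposition.refine (hθ : IsNonerasing θ) {N : ℤ → ℤ}
    (h : IsDecomposition θ (k + m) x z N) :
    ∃ y b n, IsDecomposition θ m y z b ∧ b 0 = 0 ∧ IsDecomposition θ k x y n ∧ N = n ∘ b := by
  obtain ⟨y, b, hy, hb⟩ := exists_decomposition hθ m z
  obtain ⟨x', n, hx, hn⟩ := exists_decomposition hθ k y
  have hx' := hx.shift (-(N 0)) 0
  simp only [add_zero] at hx'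
  obtain ⟨h1, h2⟩ := (hy.comp hx').unique hθ h (by simp [hb, hn])
  exact ⟨y, b, _, hy, hb, h2 ▸ hx', h1.symm⟩

end Decompositions

section IterMap

variable {A : Type*} {θ : A → List A}

/-- The map `y ↦ θ^k(y)` of the subshift to itself, where the word `θ^k(y 0)` is put at the
coordinates `[0, |θ^k(y 0)|)`. -/
noncomputable def iterMap (hθ : IsNonerasing θ) (k : ℕ) (y : subshift θ) : subshift θ :=
  ⟨(exists_decomposition hθ k y.1).choose,
    (exists_decomposition hθ k y.1).choose_spec.choose_spec.1.mem_subshift hθ y.2⟩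

theorem exists_isDecomposition_iterMap (hθ : IsNonerasing θ) (k : ℕ) (y : subshift θ) :
    ∃ n, IsDecomposition θ k (iterMap hθ k y).1 y.1 n ∧ n 0 = 0 :=
  (exists_decomposition hθ k y.1).choose_spec

theorem base_eq_image_iterMap (hθ : IsNonerasing θ) (k : ℕ) (i : A) :
    base θ k i = iterMap hθ k '' {y | y.1 0 = i} := by
  ext x
  constructor
  · rintro ⟨y, hy, n, h, h0, hi⟩
    obtain ⟨n', h', h0'⟩ := exists_isDecomposition_iterMap hθ k ⟨y, hy⟩
    exact ⟨⟨y, hy⟩, hi, Subtype.ext (h'.unique hθ h (h0'.trans h0.symm)).2⟩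
  · rintro ⟨y, hi, rfl⟩
    obtain ⟨n, h, h0⟩ := exists_isDecomposition_iterMap hθ k y
    exact ⟨y.1, y.2, n, h, h0, hi⟩

theorem base_nonempty [Finite A] (hθ : IsUniformlyPrimitive θ) (hne : (subshift θ).Nonempty)
    (k : ℕ) (i : A) : (base θ k i).Nonempty := by
  obtain ⟨y, hy⟩ := hne
  obtain ⟨j, rfl⟩ := exists_apply_eq hθ hy i
  rw [base_eq_image_iterMap hθ.isNonerasing]
  exact ⟨_, ⟨fun m => y (m + j), shift_mem hy j⟩, by simp, rfl⟩

end IterMap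

section Bases

variable {A : Type*} [TopologicalSpace A] {θ : A → List A} {k m : ℕ} {i : A} {x : subshift θ}

@[simp]
theorem shift_iterate_apply (x : subshift θ) (m : ℕ) (i : ℤ) :
    ((Speedup.shift θ)^[m] x).1 i = x.1 (i + m) := by
  induction m generalizing i with
  | zero => simp
  | succ m ih =>
    rw [Function.iterate_succ_apply']
    change ((Speedup.shift θ)^[m] x).1 (i + 1) = _
    rw [ih]
    push_cast
    ring_nf

theorem IsDecomposition.shift_iterate_mem_base {y : ℤ → A} {n : ℤ → ℤ}
    (h : IsDecomposition θ k x.1 y n) (hy : y ∈ subshift θ) {j : ℤ} (hj : n j = m) :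
    (Speedup.shift θ)^[m] x ∈ base θ k (y j) := by
  refine ⟨fun i => y (i + j), shift_mem hy j, fun i => n (i + j) - m, ?_, by simp [hj], by simp⟩
  convert h.shift m j using 1
  ext i
  simp

theorem exists_shift_iterate_height_mem_base (hx : x ∈ base θ k i) :
    ∃ i', (Speedup.shift θ)^[height θ k i] x ∈ base θ k i' := by
  obtain ⟨y, hy, n, h, h0, rfl⟩ := hx
  have hn := (h 0).1
  rw [h0, zero_add, zero_add] at hn
  exact ⟨y 1, h.shift_iterate_mem_base hy hn⟩

theorem shift_iterate_mem_base_of_add (hθ : IsNonerasing θ) (hx : x ∈ base θ (k + m) i)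
    {u v : List A} {b : A} (hi : iter θ m i = u ++ b :: v) :
    (Speedup.shift θ)^[(u.flatMap (iter θ k)).length] x ∈ base θ k b := by
  obtain ⟨z, hz, N, h, h0, rfl⟩ := hx
  obtain ⟨y, c, n, hyz, hc, hxy, rfl⟩ := h.refine hθ
  have hword := (hyz 0).2
  rw [hc] at hword
  have hu : word y 0 u.length = u := word_prefix_of_word_eq_append (hword.trans hi)
  have hb : y u.length = b := by
    have := word_prefix_of_word_eq_append (u := [b]) (word_suffix_of_word_eq_append
      (hword.trans hi))
    simpa using this
  have hcut := (hxy.word_flatMap 0 u.length).1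
  simp only [Function.comp, hc] at h0
  rw [h0, hu, zero_add, zero_add] at hcut
  rw [← hb]
  exact hxy.shift_iterate_mem_base (hyz.mem_subshift hθ hz) hcut

theorem hasBasis_nhds_subshift [DiscreteTopology A] (x : subshift θ) :
    (nhds x).HasBasis (fun _ : ℕ => True)
      fun N => {x' : subshift θ | Set.EqOn x.1 x'.1 (Set.Ico (-N) N)} := by
  refine Filter.hasBasis_iff.2 fun U => ⟨fun hU => ?_, fun ⟨N, _, hN⟩ => ?_⟩
  · obtain ⟨V, hV, hVU⟩ := (mem_nhds_subtype _ _ _).1 hU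
    rw [nhds_pi] at hV
    obtain ⟨I, t, ht, hIV⟩ := Filter.mem_pi'.1 hV
    refine ⟨I.sup Int.natAbs + 1, trivial, fun x' hx' => hVU (hIV fun i hi => ?_)⟩
    have hle : i.natAbs ≤ I.sup Int.natAbs := Finset.le_sup (f := Int.natAbs) hi
    rw [← hx' ⟨by omega, by omega⟩]
    exact mem_of_mem_nhds (ht i)
  · refine Filter.mem_of_superset ((Filter.biInter_finset_mem (Finset.Ico (-(N : ℤ)) N)).2
      fun i _ => ?_) fun x' hx' => hN fun i hi =>
        (Set.mem_iInter₂.1 hx' i (Finset.mem_Ico.2 hi) : x.1 i = x'.1 i)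
    have hcont : Continuous fun x' : subshift θ => x'.1 i :=
      (continuous_apply i).comp continuous_subtype_val
    exact ((isOpen_discrete {a | x.1 i = a}).preimage hcont).mem_nhds rfl

theorem continuous_iterMap [DiscreteTopology A] (hθ : IsNonerasing θ) (k : ℕ) :
    Continuous (iterMap hθ k) := by
  refine continuous_iff_continuousAt.2 fun y => ?_
  refine ((hasBasis_nhds_subshift y).tendsto_iff (hasBasis_nhds_subshift _)).2 fun N _ =>
    ⟨N, trivial, fun y' hy' => ?_⟩
  obtain ⟨n, hn, h0⟩ := exists_isDecomposition_iterMap hθ k y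
  obtain ⟨n', hn', h0'⟩ := exists_isDecomposition_iterMap hθ k y'
  simpa [h0] using hn.eqOn hθ hn' (h0.trans h0'.symm) hy'

theorem isClosed_base [Finite A] [DiscreteTopology A] (hθ : IsNonerasing θ) (k : ℕ) (i : A) :
    IsClosed (base θ k i) := by
  have := compactSpace_subshift θ
  have hcyl : IsClosed {y : subshift θ | y.1 0 = i} :=
    isClosed_singleton.preimage ((continuous_apply 0).comp continuous_subtype_val)
  rw [base_eq_image_iterMap hθ]
  exact (hcyl.isCompact.image (continuous_iterMap hθ k)).isClosed

theorem isClosed_floor [Finite A] [DiscreteTopology A] (hθ : IsNonerasing θ) (k : ℕ) (i : A)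
    (j : ℕ) : IsClosed (floor θ k i j) := by
  induction j with
  | zero => simpa [floor] using isClosed_base hθ k i
  | succ j ih =>
    rw [floor, Function.iterate_succ', Set.image_comp]
    exact (Speedup.shift θ).isClosedMap _ ih

/-- The reason is that all forward orbits of the shift are dense. -/
theorem eq_univ_of_isClosed_of_mapsTo_shift [Finite A] [DiscreteTopology A]
    (hθ : IsUniformlyPrimitive θ) {Y : Set (subshift θ)} (hY : IsClosed Y) (hne : Y.Nonempty)
    (hmaps : Set.MapsTo (Speedup.shift θ) Y Y) : Y = Set.univ := by
  obtain ⟨y, hy⟩ := hne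
  by_contra! hcon
  obtain ⟨z, hz⟩ := (Set.ne_univ_iff_exists_notMem Y).1 hcon
  obtain ⟨N, -, hN⟩ := (hasBasis_nhds_subshift z).mem_iff.1 (hY.isOpen_compl.mem_nhds hz)
  obtain ⟨ρ, hρ⟩ := exists_window hθ (word_mem_language z.2 (-N) (2 * N))
  obtain ⟨i, hi, -, h⟩ := hρ y.1 y.2 0
  refine hN (a := (Speedup.shift θ)^[(i + N).toNat] y) ?_ (hmaps.iterate _ hy)
  rintro j ⟨h1, h2⟩
  rw [length_word] at h
  rw [apply_eq_of_word_eq h.symm h1 (by push_cast; omega), shift_iterate_apply]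
  exact congrArg y.1 (by omega)

theorem exists_mem_floor [Finite A] [DiscreteTopology A] (hθ : IsUniformlyPrimitive θ) (k : ℕ)
    (x : subshift θ) : ∃ i j, j < height θ k i ∧ x ∈ floor θ k i j := by
  let Y : Set (subshift θ) := ⋃ i, ⋃ j ∈ Finset.range (height θ k i), floor θ k i j
  have hmem (x) : x ∈ Y ↔ ∃ i j, j < height θ k i ∧ x ∈ floor θ k i j := by simp [Y]
  have hY : IsClosed Y := isClosed_iUnion_of_finite fun i =>
    isClosed_biUnion_finset fun j _ => isClosed_floor hθ.isNonerasing k i j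
  have hne : Y.Nonempty := by
    obtain ⟨b, hb⟩ := base_nonempty hθ ⟨_, x.2⟩ k (x.1 0)
    exact ⟨b, (hmem b).2 ⟨_, 0, hθ.isNonerasing.length_pos k _, b, hb, rfl⟩⟩
  have hmaps : Set.MapsTo (Speedup.shift θ) Y Y := by
    intro x hx
    obtain ⟨i, j, hj, b, hb, rfl⟩ := (hmem x).1 hx
    rw [← Function.iterate_succ_apply' (Speedup.shift θ)]
    by_cases h : j + 1 < height θ k i
    · exact (hmem _).2 ⟨i, j + 1, h, b, hb, rfl⟩
    · obtain ⟨i', hi'⟩ := exists_shift_iterate_height_mem_base hb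
      rw [show j.succ = height θ k i by omega]
      exact (hmem _).2 ⟨i', 0, hθ.isNonerasing.length_pos k i', _, hi', rfl⟩
  rw [← hmem, eq_univ_of_isClosed_of_mapsTo_shift hθ hY hne hmaps]
  trivial

end Bases

section Balance

variable {A : Type*} {θ : A → List A} {k μ M : ℕ} {x y : ℤ → A} {n : ℤ → ℤ}

theorem IsDecomposition.add_mul_le_apply_add (h : IsDecomposition θ k x y n)
    (hμ : ∀ a, μ ≤ (iter θ k a).length) (a : ℤ) (len : ℕ) :
    n a + (len * μ : ℕ) ≤ n (a + len) := by
  have := le_length_flatMap hμ (word y a len)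
  rw [length_word] at this
  rw [(h.word_flatMap a len).1]
  omega

theorem IsDecomposition.apply_add_le_add_mul (h : IsDecomposition θ k x y n)
    (hM : ∀ a, (iter θ k a).length ≤ M) (a : ℤ) (len : ℕ) :
    n (a + len) ≤ n a + (len * M : ℕ) := by
  have := length_flatMap_le hM (word y a len)
  rw [length_word] at this
  rw [(h.word_flatMap a len).1]
  omega

theorem IsUniformlyPrimitive.exists_balanced [Finite A] (hθ : IsUniformlyPrimitive θ) :
    ∃ n₁ C : ℕ, ∀ k ≥ n₁, ∃ μ : ℕ, ∀ a, μ ≤ (iter θ k a).length ∧ (iter θ k a).length ≤ C * μ := by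
  rcases isEmpty_or_nonempty A with _ | _
  · exact ⟨0, 0, fun _ _ => ⟨0, isEmptyElim⟩⟩
  obtain ⟨n₁, hn₁⟩ := hθ
  obtain ⟨C, hC⟩ := exists_length_iter_le θ n₁
  refine ⟨n₁, C, fun k hk => ?_⟩
  obtain ⟨q, rfl⟩ := Nat.exists_eq_add_of_le' hk
  obtain ⟨b, hb⟩ := Finite.exists_max fun a => (iter θ q a).length
  refine ⟨(iter θ q b).length, fun a => ?_⟩
  rw [iter_add]
  exact ⟨(infix_flatMap_of_mem (iter θ q) (hn₁ _ le_rfl a b)).length_le,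
    (length_flatMap_le hb _).trans (Nat.mul_le_mul_right _ (hC a))⟩

end Balance

section Recognizability

variable {A : Type*} {θ : A → List A} {k e Q C μ ρ : ℕ} {x y y' z z' u u' w w' : ℤ → A}
  {n n' N N' a a' b b' α α' W : ℤ → ℤ}

theorem IsDecomposition.periodic_of_forall_mem_Ico (hθ : IsNonerasing θ)
    (h : IsDecomposition θ Q x w W) (hμ : ∀ a, μ ≤ (iter θ Q a).length)
    (hρ : IsRecurrenceBound w (C + 1) ρ) {d : ℕ} (hd : d ≤ C * μ) {j : ℤ}
    (hper : ∀ i, W j ≤ i → i < W (j + ρ) → x (i + d) = x i) : Function.Periodic x d := by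
  intro i
  have hmono := h.strictMono hθ
  obtain ⟨t, ht, ht'⟩ := exists_le_lt_succ hmono i
  obtain ⟨j', h1, h2, h3⟩ := hρ t j
  have hC := h.add_mul_le_apply_add hμ (t + 1) C
  rw [show t + 1 + (C : ℤ) = t + (C + 1 : ℕ) by push_cast; ring] at hC
  have hlen := h.sub_eq_sub_of_word_eq h h3
  have hj := hmono.monotone h1
  have hj' := hmono.monotone h2
  have e1 := h.apply_eq_of_word_eq h h3.symm (i := i) ht (by omega)
  have e2 := h.apply_eq_of_word_eq h h3.symm (i := i + d) (by omega) (by omega)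
  rw [e1, e2, ← hper (W j' + (i - W t)) (by omega) (by omega)]
  congr 1
  ring

/-- Two different occurrences of a long word at nearby places would force a period, first on an
interval and then, by recurrence, everywhere. -/
theorem IsDecomposition.eq_of_word_eq (hθ : IsNonerasing θ)
    (haper : ∀ d : ℕ, 0 < d → ¬ Function.Periodic x d) (h : IsDecomposition θ Q x w W)
    (hμ : ∀ a, μ ≤ (iter θ Q a).length ∧ (iter θ Q a).length ≤ C * μ)
    (hρ : IsRecurrenceBound w (C + 1) ρ) {p p' : ℤ} (hp : p ∈ Set.Icc (W 0) (W 1))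
    (hp' : p' ∈ Set.Icc (W 0) (W 1)) {len : ℕ} (hlen : (1 + ρ) * (C * μ) ≤ len)
    (hword : word x p len = word x p' len) : p = p' := by
  wlog hle : p ≤ p' generalizing p p'
  · exact (this hp' hp hword.symm (le_of_not_ge hle)).symm
  by_contra hne
  obtain ⟨d, hd⟩ := Int.eq_ofNat_of_zero_le (sub_nonneg.2 hle)
  have hW1 := h.apply_add_le_add_mul (fun b => (hμ b).2) 0 1
  have hWρ := h.apply_add_le_add_mul (fun b => (hμ b).2) 0 (1 + ρ)
  simp only [zero_add, Nat.cast_one, one_mul] at hW1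
  simp only [zero_add, Nat.cast_add, Nat.cast_one] at hWρ
  obtain ⟨h1, h2⟩ := hp
  have h3 := hp'.2
  refine haper d (by omega) (h.periodic_of_forall_mem_Ico hθ (fun b => (hμ b).1) hρ (d := d)
    (by omega) (j := 1) fun i hi hi' => ?_)
  rw [Speedup.apply_eq_of_word_eq hword (i := i) (by omega) (by omega)]
  congr 1
  omega

theorem IsDecomposition.eq_of_common_cut (hθ : IsNonerasing θ) (hy : IsDecomposition θ k x y n)
    (hy' : IsDecomposition θ k x y' n') (hn : 0 ∈ Set.Ico (n 0) (n 1))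
    (hn' : 0 ∈ Set.Ico (n' 0) (n' 1)) {c c' : ℤ} {len : ℕ}
    (hword : word y' c' len = word y c len) (hcut : n' c' = n c)
    (h0 : 0 ∈ Set.Ico (n' c') (n' (c' + len))) : n 0 = n' 0 ∧ y 0 = y' 0 := by
  have hmono := hy.strictMono hθ
  have hmono' := hy'.strictMono hθ
  have hc' : c' < 1 := hmono'.lt_iff_lt.1 (h0.1.trans_lt hn'.2)
  have hlen : 0 < c' + len := hmono'.lt_iff_lt.1 (hn'.1.trans_lt h0.2)
  obtain ⟨i, hi⟩ := Int.eq_ofNat_of_zero_le (show 0 ≤ -c' by omega)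
  have hprefix : ∀ m ≤ i + 1, word y' c' m = word y c m := fun m hm =>
    word_eq_word_iff.2 fun r hr => word_eq_word_iff.1 hword r (by omega)
  have e0 := hy'.sub_eq_sub_of_word_eq hy (hprefix i (by omega))
  have e1 := hy'.sub_eq_sub_of_word_eq hy (hprefix (i + 1) le_rfl)
  rw [show c' + (i : ℤ) = 0 by omega] at e0
  rw [show c' + ((i + 1 : ℕ) : ℤ) = 1 by push_cast; omega] at e1
  obtain ⟨hn0, hn1⟩ := hn'
  have hc : c + i = 0 := by
    have g0 : c + i < 1 := hmono.lt_iff_lt.1 (by have := hn.2; omega)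
    have g1 : 0 < c + (i + 1 : ℕ) := hmono.lt_iff_lt.1 (by have := hn.1; omega)
    push_cast at g1
    omega
  rw [hc] at e0
  refine ⟨by omega, ?_⟩
  rw [Speedup.apply_eq_of_word_eq hword (i := 0) (by omega) (by omega)]
  congr 1
  omega

/-- If `z` and `w` start with the same letters then so do `x` and `u`, up to the last common cut;
two such patterns in the same point `x` overlap. -/
theorem IsDecomposition.word_eq_of_common_pattern (hz : IsDecomposition θ Q x z N)
    (hz' : IsDecomposition θ Q x z' N') (hu : IsDecomposition θ Q u w b)
    (hu' : IsDecomposition θ Q u' w' b') (hb : b 0 = 0) (hb' : b' 0 = 0) {R : ℕ}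
    (hpat : word w 0 R = word z 0 R) (hpat' : word w' 0 R = word z' 0 R) {s : ℤ} (hs : 0 ≤ s)
    (hN : N' 0 = N 0 + s) {L : ℕ} (hL : s + L ≤ b R) (hL' : L ≤ b' R) :
    word u' 0 L = word u s L := by
  refine word_eq_word_iff.2 fun i hi => ?_
  rw [hu'.apply_eq_of_word_eq hz' hpat' (by omega) (by rw [zero_add (R : ℤ)]; omega),
    hu.apply_eq_of_word_eq hz hpat (i := s + i) (by omega) (by rw [zero_add (R : ℤ)]; omega)]
  congr 1
  omega

theorem IsDecomposition.cut_eq_cut_of_overlap (hθ : IsNonerasing θ)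
    (haper : ∀ d : ℕ, 0 < d → ¬ Function.Periodic x d) (hx : IsDecomposition θ k x u n)
    (hx' : IsDecomposition θ k x u' n') (hu : IsDecomposition θ Q u w b)
    (hu' : IsDecomposition θ Q u' w' b') (hb : b 0 = 0) (hb' : b' 0 = 0)
    (hμ : ∀ a, μ ≤ (iter θ (k + Q) a).length ∧ (iter θ (k + Q) a).length ≤ C * μ)
    (hρ : IsRecurrenceBound w (C + 1) ρ) {s : ℤ} (hs : s ∈ Set.Icc 0 (b 1)) {R L : ℕ}
    (hR : (1 + ρ) * C < R) (hL : (L : ℤ) = min (b' R) (b R - s))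
    (hword : word u' 0 L = word u s L) (hn : n' 0 ∈ Set.Icc (n 0) (n (b 1))) : n' 0 = n s := by
  have hw := hu.comp hx
  have hw' := hu'.comp hx'
  have hmono := (hx.strictMono hθ).monotone
  have hmono' := (hx'.strictMono hθ).monotone
  have hns : n s ≤ n (b 1) := hmono hs.2
  have hfar : n (b 1) + ((1 + ρ) * C * μ : ℕ) ≤ n (b R) :=
    (hw.add_mul_le_apply_add (fun a => (hμ a).1) 1 ((1 + ρ) * C)).trans
      (hmono ((hu.strictMono hθ).monotone (by omega)))
  have hfar' : n' 0 + ((1 + ρ) * C * μ : ℕ) ≤ n' (b' R) := by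
    refine le_trans ?_ ((hw'.add_mul_le_apply_add (fun a => (hμ a).1) 0 ((1 + ρ) * C)).trans
      (hmono' ((hu'.strictMono hθ).monotone (by omega))))
    rw [Function.comp_apply, hb']
  have hsub := hx'.sub_eq_sub_of_word_eq hx hword
  rw [zero_add] at hsub
  have hlen : ((1 + ρ) * C * μ : ℕ) ≤ n' L - n' 0 := by
    rcases min_choice (b' R) (b R - s) with h | h <;> rw [h] at hL
    · rw [hL]
      omega
    · rw [show s + (L : ℤ) = b R by omega] at hsub
      omega
  obtain ⟨Λ, hΛ⟩ := Int.eq_ofNat_of_zero_le ((Int.natCast_nonneg _).trans hlen)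
  refine hw.eq_of_word_eq hθ haper hμ hρ (len := Λ) ?_ ⟨?_, hns⟩
    (by rw [← mul_assoc]; omega) (word_eq_word_iff.2 fun i hi => ?_)
  · simpa only [Function.comp_apply, hb] using hn
  · simpa only [Function.comp_apply, hb] using hmono hs.1
  · rw [hx'.apply_eq_of_word_eq hx hword (by omega) (by rw [zero_add (L : ℤ)]; omega),
      add_sub_cancel_left]

theorem IsDecomposition.eq_of_overlap (hθ : IsNonerasing θ)
    (haper : ∀ d : ℕ, 0 < d → ¬ Function.Periodic x d)
    (hy : IsDecomposition θ k x y n) (hy' : IsDecomposition θ k x y' n')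
    (hn : 0 ∈ Set.Ico (n 0) (n 1)) (hn' : 0 ∈ Set.Ico (n' 0) (n' 1))
    (hyu : IsDecomposition θ e y u α) (hyu' : IsDecomposition θ e y' u' α')
    (hu : IsDecomposition θ Q u w b) (hu' : IsDecomposition θ Q u' w' b')
    (hb : b 0 = 0) (hb' : b' 0 = 0) (hα : 0 < α (b 1)) (hα' : 0 ∈ Set.Ico (α' 0) (α' (b' 1)))
    (hμ : ∀ a, μ ≤ (iter θ (k + e + Q) a).length ∧ (iter θ (k + e + Q) a).length ≤ C * μ)
    (hρ : IsRecurrenceBound w (C + 1) ρ) {s : ℤ} (hs : s ∈ Set.Icc 0 (b 1)) {R L : ℕ}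
    (hR : (1 + ρ) * C < R) (hL : (L : ℤ) = min (b' R) (b R - s))
    (hword : word u' 0 L = word u s L) (hle : n (α 0) ≤ n' (α' 0)) :
    n 0 = n' 0 ∧ y 0 = y' 0 := by
  have hx := hyu.comp hy
  have hx' := hyu'.comp hy'
  have hmono := hy.strictMono hθ
  have hmono' := hy'.strictMono hθ
  have h0 : n' (α' 0) ≤ 0 := (hmono'.monotone hα'.1).trans hn'.1
  have hpos : 0 < n (α (b 1)) := hn.2.trans_le (hmono.monotone hα)
  have hpos' : 0 < n' (α' (b' 1)) := hn'.2.trans_le (hmono'.monotone hα'.2)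
  have hcut : n' (α' 0) = n (α s) := hx.cut_eq_cut_of_overlap hθ haper hx' hu hu' hb hb' hμ hρ hs
    hR hL hword ⟨hle, h0.trans hpos.le⟩
  have hend : n' (α' L) = n (α (s + L)) := by
    have := hx'.sub_eq_sub_of_word_eq hx hword
    simp only [Function.comp_apply, zero_add, hcut] at this
    omega
  have hLpos : 0 < n' (α' L) := by
    rcases min_choice (b' R) (b R - s) with h | h <;> rw [h] at hL
    · rw [hL]
      exact hpos'.trans_le
        ((hx'.strictMono hθ).monotone ((hu'.strictMono hθ).monotone (by omega)))
    · rw [hend, show s + (L : ℤ) = b R by omega]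
      exact hpos.trans_le ((hx.strictMono hθ).monotone ((hu.strictMono hθ).monotone (by omega)))
  have hα_end := (hyu'.word_flatMap 0 L).1
  have hflat' := (hyu'.word_flatMap 0 L).2
  have hflat := (hyu.word_flatMap s L).2
  rw [← hword] at hflat
  rw [zero_add] at hα_end
  exact hy.eq_of_common_cut hθ hy' hn hn' (hflat'.trans hflat.symm) hcut
    ⟨h0, by rwa [← hα_end]⟩

theorem IsDecomposition.eq_of_common_pattern (hθ : IsNonerasing θ)
    (haper : ∀ d : ℕ, 0 < d → ¬ Function.Periodic x d)
    (hy : IsDecomposition θ k x y n) (hy' : IsDecomposition θ k x y' n')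
    (hn : 0 ∈ Set.Ico (n 0) (n 1)) (hn' : 0 ∈ Set.Ico (n' 0) (n' 1))
    (hz : IsDecomposition θ Q x z N) (hz' : IsDecomposition θ Q x z' N')
    (hN : 0 < N 1) (hN' : N' 0 ≤ 0)
    (hw : IsDecomposition θ (e + Q) y w a) (hw' : IsDecomposition θ (e + Q) y' w' a')
    (ha : 0 < a 1) (ha' : 0 ∈ Set.Ico (a' 0) (a' 1))
    (hμ : ∀ a, μ ≤ (iter θ (k + e + Q) a).length ∧ (iter θ (k + e + Q) a).length ≤ C * μ)
    (hρ : IsRecurrenceBound w (C + 1) ρ) {R : ℕ} (hR : (1 + ρ) * C < R)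
    (hpat : word w 0 R = word z 0 R) (hpat' : word w' 0 R = word z' 0 R)
    (hle : N 0 ≤ N' 0) (hle' : n (a 0) ≤ n' (a' 0)) : n 0 = n' 0 ∧ y 0 = y' 0 := by
  obtain ⟨u, b, α, hu, hb, hyu, rfl⟩ := hw.refine hθ
  obtain ⟨u', b', α', hu', hb', hyu', rfl⟩ := hw'.refine hθ
  simp only [Function.comp_apply, hb, hb'] at ha ha' hle'
  have hfirst : b 1 - b 0 = N 1 - N 0 := by
    simpa only [zero_add, Nat.cast_one] using hu.sub_eq_sub_of_word_eq hz (a := 0) (a' := 0)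
      (len := 1) (word_eq_word_iff.2 fun i hi => word_eq_word_iff.1 hpat i (by omega))
  obtain ⟨s, hs⟩ : ∃ s, N' 0 = N 0 + s := ⟨N' 0 - N 0, by ring⟩
  have hbR : b 1 ≤ b R := (hu.strictMono hθ).monotone (by omega)
  have hbR' : b' 0 ≤ b' R := (hu'.strictMono hθ).monotone (by omega)
  obtain ⟨L, hL⟩ := Int.eq_ofNat_of_zero_le
    (show 0 ≤ min (b' R) (b R - s) from le_min (by omega) (by omega))
  refine hy.eq_of_overlap hθ haper hy' hn hn' hyu hyu' hu hu' hb hb' ha ha' hμ hρ (s := s)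
    ⟨by omega, by omega⟩ hR hL.symm ?_ hle'
  exact hz.word_eq_of_common_pattern hz' hu hu' hb hb' hpat hpat' (by omega) hs (by omega)
    (by omega)

theorem exists_isDecomposition_of_mem_floor [TopologicalSpace A] {i : A} {j : ℕ} {x : subshift θ}
    (hx : x ∈ floor θ k i j) (hj : j < height θ k i) :
    ∃ y ∈ subshift θ, ∃ n, IsDecomposition θ k x.1 y n ∧ 0 ∈ Set.Ico (n 0) (n 1) ∧
      n 0 = -j ∧ y 0 = i := by
  obtain ⟨b, ⟨y, hy, n, h, h0, rfl⟩, rfl⟩ := hx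
  have h1 := (h 0).1
  rw [h0, zero_add, zero_add] at h1
  rw [height] at hj
  refine ⟨y, hy, fun m => n m - j, ?_, ⟨?_, ?_⟩, by simp [h0], rfl⟩
  · convert h.shift j 0 using 1 <;> ext i <;> simp
  · simp [h0]
  · change 0 < n 1 - j
    omega

theorem exists_isDecomposition_of_mem [Finite A] (hθ : IsUniformlyPrimitive θ) (k : ℕ)
    (hx : x ∈ subshift θ) :
    ∃ y ∈ subshift θ, ∃ n, IsDecomposition θ k x y n ∧ 0 ∈ Set.Ico (n 0) (n 1) := by
  let _ : TopologicalSpace A := ⊥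
  have : DiscreteTopology A := ⟨rfl⟩
  obtain ⟨i, j, hj, hmem⟩ := exists_mem_floor hθ k ⟨x, hx⟩
  obtain ⟨y, hy, n, h, h0, -⟩ := exists_isDecomposition_of_mem_floor hmem hj
  exact ⟨y, hy, n, h, h0⟩

/-- Mossé's recognizability theorem. Decompose two letter sequences `y` and `y'` over `x` at the
levels `t (k + 1) + n₁`, `t = 0, 1, …`: by the pigeonhole principle, two of these levels show the
same letters near the origin. -/
theorem IsDecomposition.eq_of_mem_Ico [Finite A] (hθ : IsUniformlyPrimitive θ)
    (haper : ∀ d : ℕ, 0 < d → ¬ Function.Periodic x d)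
    (hy : IsDecomposition θ k x y n) (hy' : IsDecomposition θ k x y' n')
    (hyX : y ∈ subshift θ) (hyX' : y' ∈ subshift θ)
    (hn : 0 ∈ Set.Ico (n 0) (n 1)) (hn' : 0 ∈ Set.Ico (n' 0) (n' 1)) :
    n 0 = n' 0 ∧ y 0 = y' 0 := by
  have hne := hθ.isNonerasing
  obtain ⟨n₁, C, hbal⟩ := hθ.exists_balanced
  obtain ⟨ρ, hρ⟩ := exists_isRecurrenceBound hθ (C + 1)
  obtain ⟨R, hR⟩ := exists_gt ((1 + ρ) * C)
  choose z hz a hza ha using fun t : ℕ => exists_isDecomposition_of_mem hθ (t * (k + 1) + n₁) hyX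
  choose z' hz' a' hza' ha' using
    fun t : ℕ => exists_isDecomposition_of_mem hθ (t * (k + 1) + n₁) hyX'
  have hfin := ((List.finite_length_eq A R).prod (List.finite_length_eq A R)).prod
    (Set.finite_univ (α := Prop × Prop))
  obtain ⟨t₁, -, t₂, -, hlt, heq⟩ := Set.infinite_univ.exists_lt_map_eq_of_mapsTo
    (f := fun t => ((word (z t) 0 R, word (z' t) 0 R),
      (n (a t 0) ≤ n' (a' t 0), n' (a' t 0) ≤ n (a t 0)))) (fun t _ => by simp) hfin
  simp only [Prod.mk.injEq, eq_iff_iff] at heq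
  obtain ⟨⟨hpat, hpat'⟩, hord, hord'⟩ := heq
  obtain ⟨e, he⟩ : ∃ e, t₂ * (k + 1) + n₁ = e + (k + (t₁ * (k + 1) + n₁)) := by
    obtain ⟨d, rfl⟩ := Nat.exists_eq_add_of_lt hlt
    exact ⟨d * (k + 1) + 1, by ring⟩
  obtain ⟨μ, hμ⟩ := hbal (k + e + (k + (t₁ * (k + 1) + n₁))) (by omega)
  have hmono := (hy.strictMono hne).monotone
  have hmono' := (hy'.strictMono hne).monotone
  rcases le_total (n (a t₁ 0)) (n' (a' t₁ 0)) with h | h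
  · exact hy.eq_of_common_pattern hne haper hy' hn hn' ((hza t₁).comp hy) ((hza' t₁).comp hy')
      (hn.2.trans_le (hmono (ha t₁).2)) ((hmono' (ha' t₁).1).trans hn'.1) (he ▸ hza t₂)
      (he ▸ hza' t₂) (ha t₂).2 (ha' t₂) hμ (hρ _ (hz t₂)) hR hpat.symm hpat'.symm h (hord.1 h)
  · have := hy'.eq_of_common_pattern hne haper hy hn' hn ((hza' t₁).comp hy') ((hza t₁).comp hy)
      (hn'.2.trans_le (hmono' (ha' t₁).2)) ((hmono (ha t₁).1).trans hn.1) (he ▸ hza' t₂)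
      (he ▸ hza t₂) (ha' t₂).2 (ha t₂) hμ (hρ _ (hz' t₂)) hR hpat'.symm hpat.symm h (hord'.1 h)
    exact ⟨this.1.symm, this.2.symm⟩

end Recognizability

section Floors

variable {A : Type*} [TopologicalSpace A] {θ : A → List A}

theorem IsAperiodic.not_periodic (haper : IsAperiodic θ) (x : subshift θ) {d : ℕ} (hd : 0 < d) :
    ¬ Function.Periodic x.1 d := fun h =>
  haper x d hd (Subtype.ext (funext fun i => (shift_iterate_apply x d i).trans (h i)))

variable [Finite A] {k : ℕ}

theorem floor_unique (hθ : IsUniformlyPrimitive θ) (haper : IsAperiodic θ) {i i' : A} {j j' : ℕ}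
    {x : subshift θ} (hx : x ∈ floor θ k i j) (hj : j < height θ k i) (hx' : x ∈ floor θ k i' j')
    (hj' : j' < height θ k i') : i = i' ∧ j = j' := by
  obtain ⟨y, hy, n, h, hn, h0, rfl⟩ := exists_isDecomposition_of_mem_floor hx hj
  obtain ⟨y', hy', n', h', hn', h0', rfl⟩ := exists_isDecomposition_of_mem_floor hx' hj'
  obtain ⟨hcut, hletter⟩ := h.eq_of_mem_Ico hθ (fun _ => haper.not_periodic x) h' hy hy' hn hn'
  exact ⟨hletter, by omega⟩

theorem isOpen_floor [DiscreteTopology A] (hθ : IsUniformlyPrimitive θ) (haper : IsAperiodic θ)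
    {i : A} {j : ℕ} (hj : j < height θ k i) : IsOpen (floor θ k i j) := by
  obtain ⟨M, hM⟩ := exists_length_iter_le θ k
  let F : Set (A × ℕ) := {q | q.2 < height θ k q.1 ∧ q ≠ (i, j)}
  have hF : F.Finite := (Set.finite_univ.prod (Set.finite_Iio M)).subset
    fun q hq => ⟨trivial, hq.1.trans_le (hM q.1)⟩
  have h : floor θ k i j = (⋃ q ∈ F, floor θ k q.1 q.2)ᶜ := by
    ext x
    rw [Set.mem_compl_iff, Set.mem_iUnion₂]
    constructor
    · rintro hx ⟨⟨i', j'⟩, ⟨hj', hne⟩, hx'⟩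
      obtain ⟨rfl, rfl⟩ := floor_unique hθ haper hx hj hx' hj'
      exact hne rfl
    · intro hx
      obtain ⟨i', j', hj', hx'⟩ := exists_mem_floor hθ k x
      by_contra hcon
      refine hx ⟨⟨i', j'⟩, ⟨hj', fun heq => ?_⟩, hx'⟩
      cases heq
      exact hcon hx'
  rw [h]
  exact (hF.isClosed_biUnion fun q _ => isClosed_floor hθ.isNonerasing k q.1 q.2).isOpen_compl

end Floors

section JumpPositions

variable {X : Type*} {T : X → X} {p : X → ℕ} {x : X} {a b b' e n : ℕ}

/-- The map `T^n x ↦ T^(p(T^n x)) (T^n x)`, read on the exponents `n` of the forward `T`-orbit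
of `x`. -/
def jumpPos (T : X → X) (p : X → ℕ) (x : X) (n : ℕ) : ℕ := n + p (T^[n] x)

/-- The path of the speedup through `T^a x` passes through `T^b x`. -/
def Reaches (T : X → X) (p : X → ℕ) (x : X) (a b : ℕ) : Prop := ∃ m, (jumpPos T p x)^[m] a = b

/-- The exponents at which the paths of the speedup enter the forward `T`-orbit of `x`. -/
def entries (T : X → X) (p : X → ℕ) (x : X) : Set ℕ := (Set.range (jumpPos T p x))ᶜ

theorem Reaches.refl (T : X → X) (p : X → ℕ) (x : X) (a : ℕ) : Reaches T p x a a := ⟨0, rfl⟩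

theorem reaches_jumpPos (T : X → X) (p : X → ℕ) (x : X) (a : ℕ) :
    Reaches T p x a (jumpPos T p x a) := ⟨1, rfl⟩

theorem Reaches.trans (h : Reaches T p x a b) (h' : Reaches T p x b n) : Reaches T p x a n := by
  obtain ⟨m, rfl⟩ := h
  obtain ⟨m', rfl⟩ := h'
  exact ⟨m' + m, Function.iterate_add_apply _ _ _ _⟩

theorem Reaches.total (h : Reaches T p x a b) (h' : Reaches T p x a b') :
    Reaches T p x b b' ∨ Reaches T p x b' b := by
  obtain ⟨m, rfl⟩ := h
  obtain ⟨m', rfl⟩ := h'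
  refine (le_total m m').imp (fun hm => ⟨m' - m, ?_⟩) fun hm => ⟨m - m', ?_⟩ <;>
    rw [← Function.iterate_add_apply, Nat.sub_add_cancel hm]

theorem Reaches.total_of_injective (hinj : Function.Injective (jumpPos T p x))
    (h : Reaches T p x b a) (h' : Reaches T p x b' a) :
    Reaches T p x b b' ∨ Reaches T p x b' b := by
  obtain ⟨m, hm⟩ := h
  obtain ⟨m', hm'⟩ := h'
  have heq := hm.trans hm'.symm
  rcases le_total m m' with hle | hle
  · refine .inr ⟨m' - m, (hinj.iterate m ?_).symm⟩
    rw [heq, ← Function.iterate_add_apply, Nat.add_sub_cancel' hle]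
  · refine .inl ⟨m - m', hinj.iterate m' ?_⟩
    rw [← heq, ← Function.iterate_add_apply, Nat.add_sub_cancel' hle]

theorem Reaches.eq_of_mem_entries (h : Reaches T p x a e) (he : e ∈ entries T p x) : a = e := by
  obtain ⟨_ | m, rfl⟩ := h
  · rfl
  · exact (he ⟨_, (Function.iterate_succ_apply' _ _ _).symm⟩).elim

theorem jumpPos_iterate (T : X → X) (p : X → ℕ) (x : X) (a n : ℕ) :
    jumpPos T p (T^[a] x) n + a = jumpPos T p x (n + a) := by
  rw [jumpPos, jumpPos, Function.iterate_add_apply]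
  omega

theorem reaches_iterate_iff :
    Reaches T p (T^[n] x) a b ↔ Reaches T p x (a + n) (b + n) := by
  have h : Function.Semiconj (· + n) (jumpPos T p (T^[n] x)) (jumpPos T p x) :=
    jumpPos_iterate T p x n
  refine exists_congr fun m => ?_
  rw [← (h.iterate_right m).eq, Nat.add_right_cancel_iff]

end JumpPositions

section BoundedSpeedups

variable {X : Type*} [TopologicalSpace X] {T S : X ≃ₜ X} {p : X → ℕ} {x : X} {a b e e' : ℕ}

theorem iterate_injective_of_forall_ne (hT : ∀ x n, 0 < n → T^[n] x ≠ x) (x : X) :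
    Function.Injective fun n => T^[n] x := by
  intro a b h
  rcases lt_trichotomy a b with hlt | rfl | hlt
  · exact (hT x _ (Nat.sub_pos_of_lt hlt) (Function.iterate_cancel T.injective h.symm)).elim
  · rfl
  · exact (hT x _ (Nat.sub_pos_of_lt hlt) (Function.iterate_cancel T.injective h)).elim

theorem IsBoundedSpeedup.le_maxJump (hS : IsBoundedSpeedup T S p) (x : X) : p x ≤ maxJump p := by
  obtain ⟨M, hM⟩ := hS.bounded
  exact le_csSup ⟨M, Set.forall_mem_range.2 hM⟩ ⟨x, rfl⟩

theorem IsBoundedSpeedup.jump_eq_iff (hS : IsBoundedSpeedup T S p)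
    (hT : ∀ x n, 0 < n → T^[n] x ≠ x) (x : X) (k : ℕ) : p x = k ↔ S x = T^[k] x := by
  rw [hS.eq_iterate, (iterate_injective_of_forall_ne hT x).eq_iff]

theorem IsBoundedSpeedup.continuous_jump [T2Space X] (hS : IsBoundedSpeedup T S p)
    (hT : ∀ x n, 0 < n → T^[n] x ≠ x) : Continuous p := by
  refine continuous_iff_isClosed.2 fun s _ => ?_
  have hs : p ⁻¹' s = ⋃ k ∈ s ∩ Set.Iic (maxJump p), {x | S x = T^[k] x} := by
    ext x
    simp only [← hS.jump_eq_iff hT, Set.mem_preimage, Set.mem_iUnion, Set.mem_inter_iff,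
      Set.mem_Iic, Set.mem_ofPred_eq, exists_prop, exists_eq_right', hS.le_maxJump x, and_true]
  rw [hs]
  exact ((Set.finite_Iic _).inter_of_right s).isClosed_biUnion fun k _ =>
    isClosed_eq S.continuous (T.continuous.iterate k)

theorem IsBoundedSpeedup.apply_iterate (hS : IsBoundedSpeedup T S p) (x : X) (n : ℕ) :
    S (T^[n] x) = T^[jumpPos T p x n] x := by
  rw [hS.eq_iterate, ← Function.iterate_add_apply, add_comm]
  rfl

theorem IsBoundedSpeedup.iterate_iterate (hS : IsBoundedSpeedup T S p) (x : X) (m n : ℕ) :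
    S^[m] (T^[n] x) = T^[(jumpPos T p x)^[m] n] x := by
  have h : Function.Semiconj (fun n => T^[n] x) (jumpPos T p x) S :=
    fun n => (hS.apply_iterate x n).symm
  exact ((h.iterate_right m).eq n).symm

theorem IsBoundedSpeedup.add_sum_jump (hS : IsBoundedSpeedup T S p) (x : X) (m n : ℕ) :
    n + ∑ r ∈ Finset.range m, p (S^[r] (T^[n] x)) = (jumpPos T p x)^[m] n := by
  induction m with
  | zero => rfl
  | succ m ih =>
    rw [Finset.sum_range_succ, ← add_assoc, ih, hS.iterate_iterate, Function.iterate_succ_apply']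
    rfl

theorem IsBoundedSpeedup.lt_jumpPos (hS : IsBoundedSpeedup T S p) (x : X) (n : ℕ) :
    n < jumpPos T p x n :=
  Nat.lt_add_of_pos_right (hS.pos _)

theorem IsBoundedSpeedup.le_of_reaches (hS : IsBoundedSpeedup T S p) (h : Reaches T p x a b) :
    a ≤ b := by
  obtain ⟨m, rfl⟩ := h
  exact Function.id_le_iterate_of_id_le (fun n => (hS.lt_jumpPos x n).le) m a

theorem IsBoundedSpeedup.iterate_jumpPos_le (hS : IsBoundedSpeedup T S p) (x : X) (m n : ℕ) :
    (jumpPos T p x)^[m] n ≤ n + m * maxJump p := by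
  induction m with
  | zero => simp
  | succ m ih =>
    rw [Function.iterate_succ_apply', add_mul, one_mul, ← add_assoc]
    exact add_le_add ih (hS.le_maxJump _)

theorem IsBoundedSpeedup.jumpPos_injective (hS : IsBoundedSpeedup T S p)
    (hT : ∀ x n, 0 < n → T^[n] x ≠ x) (x : X) : Function.Injective (jumpPos T p x) := by
  intro a b hab
  refine iterate_injective_of_forall_ne hT x (S.injective ?_)
  rw [hS.apply_iterate, hS.apply_iterate, hab]

theorem IsBoundedSpeedup.lt_maxJump_of_mem_entries (hS : IsBoundedSpeedup T S p)
    (he : e ∈ entries T p x) : e < maxJump p := by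
  by_contra hle
  obtain ⟨y, hy⟩ := S.surjective (T^[e] x)
  have hpe : p y ≤ e := (hS.le_maxJump y).trans (not_lt.1 hle)
  have hback : T^[e - p y] x = y := by
    apply T.injective.iterate (p y)
    rw [← Function.iterate_add_apply, Nat.add_sub_cancel' hpe, ← hy, hS.eq_iterate]
  refine he ⟨e - p y, ?_⟩
  rw [jumpPos, hback, Nat.sub_add_cancel hpe]

theorem IsBoundedSpeedup.finite_entries (hS : IsBoundedSpeedup T S p) (x : X) :
    (entries T p x).Finite :=
  (Set.finite_Iio (maxJump p)).subset fun _ => hS.lt_maxJump_of_mem_entries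

theorem IsBoundedSpeedup.zero_mem_entries (hS : IsBoundedSpeedup T S p) (x : X) :
    0 ∈ entries T p x := by
  rintro ⟨n, hn⟩
  exact Nat.not_lt_zero n (hn ▸ hS.lt_jumpPos x n)

theorem IsBoundedSpeedup.exists_mem_entries_reaches (hS : IsBoundedSpeedup T S p) (x : X)
    (n : ℕ) : ∃ e ∈ entries T p x, Reaches T p x e n := by
  induction n using Nat.strong_induction_on with
  | _ n ih =>
    by_cases hn : n ∈ entries T p x
    · exact ⟨n, hn, .refl T p x n⟩
    · obtain ⟨n', rfl⟩ := Set.notMem_compl_iff.1 hn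
      obtain ⟨e, he, h⟩ := ih n' (hS.lt_jumpPos x n')
      exact ⟨e, he, h.trans (reaches_jumpPos T p x n')⟩

theorem IsBoundedSpeedup.eq_of_reaches (hS : IsBoundedSpeedup T S p)
    (hT : ∀ x n, 0 < n → T^[n] x ≠ x) (he : e ∈ entries T p x) (he' : e' ∈ entries T p x)
    (h : Reaches T p x e b) (h' : Reaches T p x e' b) : e = e' := by
  rcases h.total_of_injective (hS.jumpPos_injective hT x) h' with h | h
  · exact h.eq_of_mem_entries he'
  · exact (h.eq_of_mem_entries he).symm

theorem IsBoundedSpeedup.mem_entries_iterate (hS : IsBoundedSpeedup T S p)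
    (hT : ∀ x n, 0 < n → T^[n] x ≠ x) {h j : ℕ} (hj : j < h)
    (hjump : jumpPos T p x j = e + h) : e ∈ entries T p (T^[h] x) := by
  rintro ⟨n, rfl⟩
  rw [jumpPos_iterate] at hjump
  have := hS.jumpPos_injective hT x hjump
  omega

theorem IsBoundedSpeedup.entries_congr (hS : IsBoundedSpeedup T S p) {x x' : X}
    (h : ∀ n ≤ maxJump p, p (T^[n] x) = p (T^[n] x')) : entries T p x = entries T p x' := by
  have hsub : ∀ {x x' : X}, (∀ n ≤ maxJump p, p (T^[n] x) = p (T^[n] x')) →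
      entries T p x ⊆ entries T p x' := by
    rintro x x' h e he ⟨n, rfl⟩
    have hn := (hS.lt_jumpPos x' n).trans (hS.lt_maxJump_of_mem_entries he)
    exact he ⟨n, by rw [jumpPos, jumpPos, h n hn.le]⟩
  exact (hsub h).antisymm (hsub fun n hn => (h n hn).symm)

end BoundedSpeedups

section Orbits

variable {X : Type*} [TopologicalSpace X] {f T S : X ≃ₜ X} {p : X → ℕ} {x y : X} {a b : ℕ}

theorem zpow_natCast_apply (f : X ≃ₜ X) (n : ℕ) (x : X) : (f ^ (n : ℤ)) x = f^[n] x := by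
  rw [zpow_natCast]
  induction n generalizing x with
  | zero => rfl
  | succ n ih => rw [pow_succ, Homeomorph.mul_apply, Function.iterate_succ_apply, ih]

theorem mem_orbit_self (f : X ≃ₜ X) (x : X) : x ∈ orbit f x := ⟨0, rfl⟩

theorem orbit_eq_of_mem (h : y ∈ orbit f x) : orbit f y = orbit f x := by
  obtain ⟨j, rfl⟩ := h
  change Set.range (fun i : ℤ => (f ^ i) ((f ^ j) x)) = _
  simp only [← Homeomorph.mul_apply, ← zpow_add]
  exact (Equiv.addRight j).surjective.range_comp fun i : ℤ => (f ^ i) x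

theorem orbit_iterate (f : X ≃ₜ X) (x : X) (n : ℕ) : orbit f (f^[n] x) = orbit f x :=
  orbit_eq_of_mem ⟨n, zpow_natCast_apply f n x⟩

theorem exists_iterate_eq_of_mem_orbit (h : y ∈ orbit f x) :
    ∃ n : ℕ, f^[n] x = y ∨ f^[n] y = x := by
  obtain ⟨j, rfl⟩ := h
  obtain ⟨n, rfl | rfl⟩ := j.eq_nat_or_neg
  · exact ⟨n, .inl (zpow_natCast_apply f n x).symm⟩
  · refine ⟨n, .inr ?_⟩
    change f^[n] ((f ^ (-(n : ℤ))) x) = x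
    rw [← zpow_natCast_apply, ← Homeomorph.mul_apply, ← zpow_add, add_neg_cancel, zpow_zero,
      Homeomorph.one_apply]

theorem IsBoundedSpeedup.orbit_eq_of_reaches (hS : IsBoundedSpeedup T S p)
    (h : Reaches T p x a b) : orbit S (T^[a] x) = orbit S (T^[b] x) := by
  obtain ⟨m, rfl⟩ := h
  rw [← hS.iterate_iterate, orbit_iterate]

theorem IsBoundedSpeedup.orbit_subset (hS : IsBoundedSpeedup T S p) (x : X) :
    orbit S x ⊆ orbit T x := by
  have horbit : ∀ m y, orbit T (S^[m] y) = orbit T y := by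
    intro m y
    have := hS.iterate_iterate y m 0
    rw [Function.iterate_zero_apply] at this
    rw [this, orbit_iterate]
  intro y hy
  obtain ⟨m, rfl | rfl⟩ := exists_iterate_eq_of_mem_orbit hy
  · exact horbit m x ▸ mem_orbit_self T _
  · exact horbit m y ▸ mem_orbit_self T _

theorem IsBoundedSpeedup.exists_orbit_iterate_eq (hS : IsBoundedSpeedup T S p)
    (h : y ∈ orbit T x) : ∃ n, orbit S (T^[n] x) = orbit S y := by
  obtain ⟨i, rfl | rfl⟩ := exists_iterate_eq_of_mem_orbit h
  · exact ⟨i, rfl⟩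
  · have hmono : StrictMono fun m => (jumpPos T p y)^[m] 0 := strictMono_nat_of_lt_succ fun m => by
      rw [Function.iterate_succ_apply']
      exact hS.lt_jumpPos y _
    obtain ⟨n, hn⟩ := Nat.exists_eq_add_of_le' (hmono.le_apply (x := i))
    refine ⟨n, ?_⟩
    rw [← Function.iterate_add_apply, ← hn, ← hS.orbit_eq_of_reaches ⟨i, rfl⟩,
      Function.iterate_zero_apply]

theorem IsBoundedSpeedup.injOn_orbit_entries (hS : IsBoundedSpeedup T S p)
    (hT : ∀ x n, 0 < n → T^[n] x ≠ x) (x : X) :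
    Set.InjOn (fun e => orbit S (T^[e] x)) (entries T p x) := by
  have heq : ∀ {e e' : ℕ} (m : ℕ), e' ∈ entries T p x → S^[m] (T^[e] x) = T^[e'] x → e = e' := by
    intro e e' m he' h
    rw [hS.iterate_iterate] at h
    exact Reaches.eq_of_mem_entries ⟨m, iterate_injective_of_forall_ne hT x h⟩ he'
  intro e he e' he' h
  have hmem : T^[e'] x ∈ orbit S (T^[e] x) := by
    simp only at h
    exact h ▸ mem_orbit_self S _
  obtain ⟨m, hm | hm⟩ := exists_iterate_eq_of_mem_orbit hmem
  · exact heq m he' hm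
  · exact (heq m he hm).symm

theorem IsBoundedSpeedup.encard_orbits (hS : IsBoundedSpeedup T S p)
    (hT : ∀ x n, 0 < n → T^[n] x ≠ x) (x : X) :
    {O : Set X | (∃ y, O = orbit S y) ∧ O ⊆ orbit T x}.encard = (entries T p x).encard := by
  rw [← (hS.injOn_orbit_entries hT x).encard_image]
  congr 1
  refine Set.Subset.antisymm ?_ ?_
  · rintro _ ⟨⟨y, rfl⟩, hO⟩
    obtain ⟨n, hn⟩ := hS.exists_orbit_iterate_eq (hO (mem_orbit_self S y))
    obtain ⟨e, he, hen⟩ := hS.exists_mem_entries_reaches x n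
    exact ⟨e, he, (hS.orbit_eq_of_reaches hen).trans hn⟩
  · rintro _ ⟨e, -, rfl⟩
    exact ⟨⟨_, rfl⟩, (hS.orbit_subset _).trans (orbit_iterate T x e).subset⟩

theorem IsMinimalHomeo.exists_return_time [CompactSpace X] (hf : IsMinimalHomeo f) {U : Set X}
    (hU : IsOpen U) (hne : U.Nonempty) : ∃ N : ℕ, ∀ x, ∃ n ≤ N, f^[n] x ∈ U := by
  obtain ⟨I, hI⟩ := isCompact_univ.elim_finite_subcover (fun j : ℤ => ⇑(f ^ j) ⁻¹' U)
    (fun j => hU.preimage (f ^ j).continuous) (by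
      intro x _
      obtain ⟨_, hy, j, rfl⟩ := (hf x).inter_open_nonempty U hU hne
      exact Set.mem_iUnion.2 ⟨j, hy⟩)
  set N := I.sup Int.natAbs
  refine ⟨2 * N, fun x => ?_⟩
  -- Starting from `f^N x`, the visits at the times in `I` are in the future of `x`.
  obtain ⟨j, hj, hjU⟩ := Set.mem_iUnion₂.1 (hI (Set.mem_univ (f^[N] x)))
  have hjN : j.natAbs ≤ N := Finset.le_sup (f := Int.natAbs) hj
  refine ⟨(j + N).toNat, by omega, ?_⟩
  rw [← zpow_natCast_apply, Int.toNat_of_nonneg (by omega), zpow_add, Homeomorph.mul_apply,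
    zpow_natCast_apply]
  exact hjU

end Orbits

section LocalConstancy

variable {A : Type*} {θ : A → List A} {k m N : ℕ} {i : A} {x x' : subshift θ}

theorem word_of_mem_base (hx : x ∈ base θ k i) : word x.1 0 (height θ k i) = iter θ k i := by
  obtain ⟨y, -, n, h, h0, rfl⟩ := hx
  simpa [h0, height] using (h 0).2

theorem word_prefix_of_mem_base {l : A} (hl : ∀ a, (iter θ k a).head? = some l)
    (hx : x ∈ base θ (m + k) i) : word x.1 0 (iter θ m l).length = iter θ m l := by
  obtain ⟨w, hw⟩ := List.head?_eq_some_iff.1 (hl i)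
  have hword := word_of_mem_base hx
  rw [iter_add, hw, List.flatMap_cons] at hword
  exact word_prefix_of_word_eq_append hword

theorem word_suffix_of_mem_base {r : A} (hr : ∀ a, (iter θ k a).getLast? = some r)
    (hx : x ∈ base θ (m + k) i) :
    word x.1 (-(iter θ m r).length) (iter θ m r).length = iter θ m r := by
  obtain ⟨y, -, n, h, h0, -⟩ := hx
  obtain ⟨hlen, hword⟩ := h (-1)
  obtain ⟨w, hw⟩ := List.getLast?_eq_some_iff.1 (hr (y (-1)))
  rw [iter_add, hw, List.flatMap_append, List.flatMap_singleton] at hlen hword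
  rw [List.length_append, Nat.cast_add, neg_add_cancel, h0] at hlen
  convert word_suffix_of_word_eq_append hword using 2
  omega

theorem exists_eqOn_of_mem_base (hθ : IsPrimitive θ) (hp : IsProper θ) (N : ℕ) :
    ∃ k₀, ∀ k ≥ k₀, ∀ x ∈ ⋃ i, base θ k i, ∀ x' ∈ ⋃ i, base θ k i,
      Set.EqOn x.1 x'.1 (Set.Ico (-N) N) := by
  obtain ⟨l, r, k₁, hlr⟩ := hp
  obtain ⟨m₀, hm₀⟩ := Filter.eventually_atTop.1
    (((hθ.length_tendsto l).eventually_ge_atTop N).and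
      ((hθ.length_tendsto r).eventually_ge_atTop N))
  refine ⟨m₀ + k₁, fun k hk x hx x' hx' t ⟨ht, ht'⟩ => ?_⟩
  obtain ⟨m, rfl⟩ := Nat.exists_eq_add_of_le' (show k₁ ≤ k by omega)
  obtain ⟨hl, hr⟩ := hm₀ m (by omega)
  obtain ⟨i, hx⟩ := Set.mem_iUnion.1 hx
  obtain ⟨i', hx'⟩ := Set.mem_iUnion.1 hx'
  rcases lt_or_ge t 0 with hneg | hnonneg
  · have hsuffix := (word_suffix_of_mem_base (fun a => (hlr a).2) hx).trans
      (word_suffix_of_mem_base (fun a => (hlr a).2) hx').symm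
    simpa using apply_eq_of_word_eq hsuffix (i := t) (by omega) (by omega)
  · have hprefix := (word_prefix_of_mem_base (fun a => (hlr a).1) hx).trans
      (word_prefix_of_mem_base (fun a => (hlr a).1) hx').symm
    simpa using apply_eq_of_word_eq hprefix (i := t) hnonneg (by omega)

variable [TopologicalSpace A]

theorem eqOn_of_mem_floor
    (hbase : ∀ x ∈ ⋃ i, base θ k i, ∀ x' ∈ ⋃ i, base θ k i, Set.EqOn x.1 x'.1 (Set.Ico (-N) N))
    {j : ℕ} (hj : j < height θ k i) (hx : x ∈ floor θ k i j) (hx' : x' ∈ floor θ k i j) :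
    Set.EqOn x.1 x'.1 (Set.Ico (-N) N) := by
  obtain ⟨b, hb, rfl⟩ := hx
  obtain ⟨b', hb', rfl⟩ := hx'
  rintro t ⟨ht, ht'⟩
  rw [shift_iterate_apply, shift_iterate_apply]
  rcases lt_or_ge (t + j) 0 with hneg | hnonneg
  · exact hbase b (Set.mem_iUnion_of_mem i hb) b' (Set.mem_iUnion_of_mem i hb')
      ⟨by omega, by omega⟩
  rcases lt_or_ge (t + j) (height θ k i) with hlt | hge
  · have hword := (word_of_mem_base hb).trans (word_of_mem_base hb').symm
    simpa using apply_eq_of_word_eq hword hnonneg (by omega)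
  · obtain ⟨c, hc⟩ := exists_shift_iterate_height_mem_base hb
    obtain ⟨c', hc'⟩ := exists_shift_iterate_height_mem_base hb'
    have := hbase _ (Set.mem_iUnion_of_mem c hc) _ (Set.mem_iUnion_of_mem c' hc')
      (show t + j - height θ k i ∈ Set.Ico (-N : ℤ) N from ⟨by omega, by omega⟩)
    simpa using this

theorem exists_eqOn_imp_eq [Finite A] [DiscreteTopology A] {p : subshift θ → ℕ}
    (hp : Continuous p) :
    ∃ N : ℕ, ∀ x x' : subshift θ, Set.EqOn x.1 x'.1 (Set.Ico (-N) N) → p x = p x' := by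
  have := compactSpace_subshift θ
  have hloc : ∀ x : subshift θ, ∃ N : ℕ, ∀ x' : subshift θ,
      Set.EqOn x.1 x'.1 (Set.Ico (-N) N) → p x' = p x := fun x => by
    obtain ⟨N, -, hN⟩ := (hasBasis_nhds_subshift x).mem_iff.1
      (((isOpen_discrete {p x}).preimage hp).mem_nhds rfl)
    exact ⟨N, fun x' h => hN h⟩
  choose N hN using hloc
  obtain ⟨I, -, hI⟩ := isCompact_univ.elim_nhds_subcover
    (fun x => {x' : subshift θ | Set.EqOn x.1 x'.1 (Set.Ico (-N x) (N x))})
    fun x _ => (hasBasis_nhds_subshift x).mem_of_mem trivial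
  refine ⟨I.sup N, fun x x' h => ?_⟩
  obtain ⟨z, hz, hzx⟩ := Set.mem_iUnion₂.1 (hI (Set.mem_univ x))
  have hle : (N z : ℤ) ≤ I.sup N := by exact_mod_cast Finset.le_sup (f := N) hz
  rw [hN z x hzx, hN z x' (hzx.trans (h.mono (Set.Ico_subset_Ico (by omega) hle)))]

end LocalConstancy

section LargeLevels

variable {A : Type*} [TopologicalSpace A] {θ : A → List A} {S : subshift θ ≃ₜ subshift θ}
  {p : subshift θ → ℕ} {k m : ℕ} {i : A} {x x' : subshift θ}

theorem exists_isLarge [Finite A] [DiscreteTopology A] (hθ : IsPrimitive θ) (hp : IsProper θ)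
    (hcont : Continuous p) : ∃ k₀, ∀ k ≥ k₀, IsLarge θ p k := by
  obtain ⟨N, hN⟩ := exists_eqOn_imp_eq hcont
  obtain ⟨k₁, hk₁⟩ := exists_eqOn_of_mem_base hθ hp (N + maxJump p)
  have htall : ∀ᶠ k in Filter.atTop, ∀ i, maxJump p + 1 ≤ (iter θ k i).length :=
    Filter.eventually_all.2 fun i => (hθ.length_tendsto i).eventually_ge_atTop _
  obtain ⟨k₂, hk₂⟩ := Filter.eventually_atTop.1 htall
  refine ⟨k₁ + k₂, fun k hk => ⟨fun i j hj x hx x' hx' => ?_, hk₂ k (by omega), ?_⟩⟩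
  · exact hN x x' ((eqOn_of_mem_floor (hk₁ k (by omega)) hj hx hx').mono
      (Set.Ico_subset_Ico (by omega) (by omega)))
  · rintro n hn _ ⟨x, hx, rfl⟩ _ ⟨x', hx', rfl⟩
    refine hN _ _ fun t ⟨ht, ht'⟩ => ?_
    rw [shift_iterate_apply, shift_iterate_apply]
    exact hk₁ k (by omega) x hx x' hx' ⟨by omega, by omega⟩

theorem exists_mem_base_of_add (hθ : IsNonerasing θ) (hx : x ∈ base θ (k + m) i) :
    ∃ b ∈ iter θ m i, x ∈ base θ k b := by
  obtain ⟨b, v, hv⟩ := List.exists_cons_of_ne_nil (hθ.iter_ne_nil m i)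
  exact ⟨b, by simp [hv], shift_iterate_mem_base_of_add hθ hx (u := []) hv⟩

theorem IsLarge.add (hθ : IsNonerasing θ) (hk : IsLarge θ p k) (m : ℕ) : IsLarge θ p (k + m) := by
  have hbase : ⋃ i, base θ (k + m) i ⊆ ⋃ i, base θ k i := Set.iUnion_subset fun i x hx => by
    obtain ⟨b, -, hb⟩ := exists_mem_base_of_add hθ hx
    exact Set.mem_iUnion_of_mem b hb
  refine ⟨fun i j hj => ?_, fun i => ?_, fun n hn x hx x' hx' => ?_⟩
  · rw [height, iter_add] at hj
    obtain ⟨u, b, v, hi, hu, hub⟩ := exists_split_flatMap hj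
    have hfloor : floor θ (k + m) i j ⊆ floor θ k b (j - (u.flatMap (iter θ k)).length) := by
      rintro _ ⟨x, hx, rfl⟩
      refine ⟨_, shift_iterate_mem_base_of_add hθ hx hi, ?_⟩
      rw [← Function.iterate_add_apply, Nat.sub_add_cancel hu]
    intro x hx x' hx'
    exact hk.jump_const b _ (by rw [height]; omega) x (hfloor hx) x' (hfloor hx')
  · obtain ⟨b, v, hv⟩ := List.exists_cons_of_ne_nil (hθ.iter_ne_nil m i)
    refine (hk.tall b).trans_le ?_
    rw [height, height, iter_add]
    exact (infix_flatMap_of_mem (iter θ k) (by simp [hv])).length_le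
  · exact hk.low_floors n hn x (Set.image_mono hbase hx) x' (Set.image_mono hbase hx')

theorem IsLarge.entries_eq (hk : IsLarge θ p k) (hS : IsBoundedSpeedup (shift θ) S p)
    (hx : x ∈ ⋃ i, base θ k i) (hx' : x' ∈ ⋃ i, base θ k i) :
    entries (shift θ) p x = entries (shift θ) p x' :=
  hS.entries_congr fun n hn => hk.low_floors n hn _ ⟨x, hx, rfl⟩ _ ⟨x', hx', rfl⟩

theorem IsLarge.isOrbitNumber_iff [Finite A] [DiscreteTopology A] (hθ : IsUniformlyPrimitive θ)
    (haper : IsAperiodic θ) (hk : IsLarge θ p k) (hS : IsBoundedSpeedup (shift θ) S p)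
    (hx : x ∈ ⋃ i, base θ k i) (c : ℕ) :
    IsOrbitNumber (shift θ) S c ↔ (entries (shift θ) p x).encard = c := by
  refine ⟨fun h => (hS.encard_orbits haper x).symm.trans (h x), fun h x' => ?_⟩
  obtain ⟨i, j, -, b, hb, rfl⟩ := exists_mem_floor hθ k x'
  rw [orbit_iterate, hS.encard_orbits haper, ← h,
    hk.entries_eq hS hx (Set.mem_iUnion_of_mem i hb)]

theorem exists_floor_subset [Finite A] [DiscreteTopology A] (hθ : IsPrimitive θ) (hp : IsProper θ)
    {U : Set (subshift θ)} (hU : IsOpen U) (hne : U.Nonempty) :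
    ∃ k₀, ∀ k ≥ k₀, ∃ i j, j < height θ k i ∧ floor θ k i j ⊆ U := by
  obtain ⟨z, hz⟩ := hne
  obtain ⟨N, -, hN⟩ := (hasBasis_nhds_subshift z).mem_iff.1 (hU.mem_nhds hz)
  obtain ⟨k₀, hk₀⟩ := exists_eqOn_of_mem_base hθ hp N
  refine ⟨k₀, fun k hk => ?_⟩
  obtain ⟨i, j, hj, hzfloor⟩ := exists_mem_floor (hθ.isUniformlyPrimitive hp) k z
  exact ⟨i, j, hj, fun x hx => hN (eqOn_of_mem_floor (hk₀ k hk) hj hzfloor hx)⟩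

end LargeLevels

section EntryLists

variable {A : Type*} [TopologicalSpace A] {θ : A → List A} {S : subshift θ ≃ₜ subshift θ}
  {p : subshift θ → ℕ} {c k : ℕ} {e : Fin c → ℕ} {i : A} {x x' : subshift θ}

/-- `e` lists, in increasing order, the heights at which the `S`-paths enter the columns of
level `k`. The path that enters at height `e ℓ` turns out to be the one with label `ℓ`. -/
structure IsEntryList (θ : A → List A) (p : subshift θ → ℕ) (k : ℕ) (e : Fin c → ℕ) : Prop where
  strictMono : StrictMono e
  range_eq : ∀ x ∈ ⋃ i, base θ k i, Set.range e = entries (shift θ) p x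

theorem IsLarge.exists_isEntryList (hk : IsLarge θ p k) (hS : IsBoundedSpeedup (shift θ) S p)
    (hx : x ∈ ⋃ i, base θ k i) (hc : (entries (shift θ) p x).encard = c) :
    ∃ e : Fin c → ℕ, IsEntryList θ p k e := by
  have hfin : (entries (shift θ) p x).Finite := Set.finite_of_encard_eq_coe hc
  have hcard : hfin.toFinset.card = c := by
    rw [hfin.encard_eq_coe_toFinset_card] at hc
    exact_mod_cast hc
  refine ⟨hfin.toFinset.orderEmbOfFin hcard, (hfin.toFinset.orderEmbOfFin hcard).strictMono,
    fun x' hx' => ?_⟩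
  rw [hk.entries_eq hS hx' hx, Finset.range_orderEmbOfFin, hfin.coe_toFinset]

theorem IsEntryList.add (hθ : IsNonerasing θ) (he : IsEntryList θ p k e) (m : ℕ) :
    IsEntryList θ p (k + m) e := by
  refine ⟨he.strictMono, fun x hx => ?_⟩
  obtain ⟨i, hx⟩ := Set.mem_iUnion.1 hx
  obtain ⟨b, -, hb⟩ := exists_mem_base_of_add hθ hx
  exact he.range_eq x (Set.mem_iUnion_of_mem b hb)

theorem IsEntryList.mem_entries (he : IsEntryList θ p k e) (hx : x ∈ base θ k i) (ℓ : Fin c) :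
    e ℓ ∈ entries (shift θ) p x :=
  he.range_eq x (Set.mem_iUnion_of_mem i hx) ▸ Set.mem_range_self ℓ

theorem IsEntryList.exists_eq (he : IsEntryList θ p k e) (hx : x ∈ base θ k i) {n : ℕ}
    (hn : n ∈ entries (shift θ) p x) : ∃ ℓ, e ℓ = n := by
  rwa [← he.range_eq x (Set.mem_iUnion_of_mem i hx)] at hn

theorem IsEntryList.exists_reaches (he : IsEntryList θ p k e)
    (hS : IsBoundedSpeedup (shift θ) S p) (hx : x ∈ base θ k i) (n : ℕ) :
    ∃ ℓ, Reaches (shift θ) p x (e ℓ) n := by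
  obtain ⟨r, hr, h⟩ := hS.exists_mem_entries_reaches x n
  obtain ⟨ℓ, rfl⟩ := he.exists_eq hx hr
  exact ⟨ℓ, h⟩

theorem IsEntryList.eq_of_reaches (he : IsEntryList θ p k e) (haper : IsAperiodic θ)
    (hS : IsBoundedSpeedup (shift θ) S p) (hx : x ∈ base θ k i) {n : ℕ} {ℓ ℓ' : Fin c}
    (h : Reaches (shift θ) p x (e ℓ) n) (h' : Reaches (shift θ) p x (e ℓ') n) : ℓ = ℓ' :=
  he.strictMono.injective
    (hS.eq_of_reaches haper (he.mem_entries hx ℓ) (he.mem_entries hx ℓ') h h')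

theorem IsEntryList.eq_of_reaches_entry (he : IsEntryList θ p k e) (hx : x ∈ base θ k i)
    {ℓ ℓ' : Fin c} (h : Reaches (shift θ) p x (e ℓ) (e ℓ')) : ℓ = ℓ' :=
  he.strictMono.injective (h.eq_of_mem_entries (he.mem_entries hx ℓ'))

theorem IsEntryList.eq_of_reaches_add (he : IsEntryList θ p k e) {d a : ℕ} {ℓ ℓ' : Fin c}
    (hx : (shift θ)^[d] x ∈ base θ k i) (h : Reaches (shift θ) p x a (e ℓ + d))
    (h' : Reaches (shift θ) p x a (e ℓ' + d)) : ℓ = ℓ' := by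
  rcases h.total h' with h | h
  · exact he.eq_of_reaches_entry hx (reaches_iterate_iff.2 h)
  · exact (he.eq_of_reaches_entry hx (reaches_iterate_iff.2 h)).symm

theorem IsEntryList.lt_height (he : IsEntryList θ p k e) (hk : IsLarge θ p k)
    (hS : IsBoundedSpeedup (shift θ) S p) (hx : x ∈ base θ k i) (ℓ : Fin c) :
    e ℓ < height θ k i :=
  (hS.lt_maxJump_of_mem_entries (he.mem_entries hx ℓ)).trans (hk.tall i)

theorem IsEntryList.exists_orbit_eq [Finite A] [DiscreteTopology A]
    (he : IsEntryList θ p k e) (hθ : IsUniformlyPrimitive θ)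
    (hS : IsBoundedSpeedup (shift θ) S p) (x : subshift θ) :
    ∃ i, ∃ y ∈ base θ k i, ∃ ℓ, orbit S ((shift θ)^[e ℓ] y) = orbit S x := by
  obtain ⟨i, j, -, y, hy, rfl⟩ := exists_mem_floor hθ k x
  obtain ⟨ℓ, hℓ⟩ := he.exists_reaches hS hy j
  exact ⟨i, y, hy, ℓ, hS.orbit_eq_of_reaches hℓ⟩

end EntryLists

section Labels

variable {A : Type*} [TopologicalSpace A] {θ : A → List A} {S : subshift θ ≃ₜ subshift θ}
  {p : subshift θ → ℕ} {c k : ℕ} {e : Fin c → ℕ} {i : A} {x x' : subshift θ} {ℓ : Fin c}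
  {a j : ℕ}

theorem IsLarge.jumpPos_eq (hk : IsLarge θ p k) (hx : x ∈ base θ k i) (hx' : x' ∈ base θ k i)
    (hj : j < height θ k i) : jumpPos (shift θ) p x j = jumpPos (shift θ) p x' j := by
  rw [jumpPos, jumpPos, hk.jump_const i j hj _ ⟨x, hx, rfl⟩ _ ⟨x', hx', rfl⟩]

theorem IsLarge.iterate_jumpPos_eq (hk : IsLarge θ p k) (hS : IsBoundedSpeedup (shift θ) S p)
    (hx : x ∈ base θ k i) (hx' : x' ∈ base θ k i) {m : ℕ}
    (hm : (jumpPos (shift θ) p x)^[m] a < height θ k i) :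
    (jumpPos (shift θ) p x)^[m] a = (jumpPos (shift θ) p x')^[m] a := by
  induction m with
  | zero => rfl
  | succ m ih =>
    rw [Function.iterate_succ_apply'] at hm
    have hm' := (hS.lt_jumpPos x _).trans hm
    rw [Function.iterate_succ_apply', Function.iterate_succ_apply', ← ih hm',
      hk.jumpPos_eq hx hx' hm']

theorem IsLarge.reaches_of_reaches (hk : IsLarge θ p k) (hS : IsBoundedSpeedup (shift θ) S p)
    (hx : x ∈ base θ k i) (hx' : x' ∈ base θ k i) (hj : j < height θ k i)
    (h : Reaches (shift θ) p x a j) : Reaches (shift θ) p x' a j := by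
  obtain ⟨m, rfl⟩ := h
  exact ⟨m, (hk.iterate_jumpPos_eq hS hx hx' hj).symm⟩

theorem IsLarge.climbs_iff (hk : IsLarge θ p k) (hS : IsBoundedSpeedup (shift θ) S p)
    (hx : x ∈ base θ k i) (hj : j < height θ k i) :
    Climbs θ S p k i a j ↔ Reaches (shift θ) p x a j := by
  refine exists_congr fun m => ⟨fun h => ?_, ?_⟩
  · rw [← hS.add_sum_jump]
    exact h _ ⟨x, hx, rfl⟩
  · rintro rfl _ ⟨x', hx', rfl⟩
    rw [hS.add_sum_jump, hk.iterate_jumpPos_eq hS hx hx' hj]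

theorem IsEntryList.isLeast_reaches (he : IsEntryList θ p k e) (hk : IsLarge θ p k)
    (hS : IsBoundedSpeedup (shift θ) S p) (hx : x ∈ base θ k i) (ℓ : Fin c) :
    IsLeast {t | t < height θ k i ∧ ∃ q, ℓ ≤ q ∧ Reaches (shift θ) p x (e q) t} (e ℓ) := by
  refine ⟨⟨he.lt_height hk hS hx ℓ, ℓ, le_rfl, .refl _ _ _ _⟩, ?_⟩
  rintro t ⟨-, q, hq, h⟩
  exact (he.strictMono.monotone hq).trans (hS.le_of_reaches h)

theorem IsLarge.hasLabel_iff (hk : IsLarge θ p k) (haper : IsAperiodic θ)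
    (hS : IsBoundedSpeedup (shift θ) S p) (he : IsEntryList θ p k e) (hx : x ∈ base θ k i) :
    HasLabel θ S p k i ℓ j ↔ j < height θ k i ∧ Reaches (shift θ) p x (e ℓ) j := by
  induction ℓ using WellFoundedLT.induction generalizing j with
  | _ ℓ ih =>
    have hunlabeled : {t | t < height θ k i ∧ ∀ m, ∀ _ : m < (ℓ : ℕ), ¬ HasLabel θ S p k i m t}
        = {t | t < height θ k i ∧ ∃ q, ℓ ≤ q ∧ Reaches (shift θ) p x (e q) t} := by
      ext t
      refine and_congr_right fun ht => ⟨fun h => ?_, ?_⟩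
      · obtain ⟨q, hq⟩ := he.exists_reaches hS hx t
        exact ⟨q, not_lt.1 fun hlt => h q hlt ((ih q hlt).2 ⟨ht, hq⟩), hq⟩
      · rintro ⟨q, hq, h⟩ m hm hlabel
        have hmℓ : (⟨m, hm.trans ℓ.isLt⟩ : Fin c) < ℓ := hm
        obtain rfl := he.eq_of_reaches haper hS hx h ((ih _ hmℓ).1 hlabel).2
        exact hq.not_gt hmℓ
    have hleast := he.isLeast_reaches hk hS hx ℓ
    rw [HasLabel, hunlabeled]
    refine ⟨?_, fun ⟨hj, h⟩ => ⟨e ℓ, hleast, hj, (hk.climbs_iff hS hx hj).2 h⟩⟩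
    rintro ⟨s, hs, hj, h⟩
    obtain rfl := hs.unique hleast
    exact ⟨hj, (hk.climbs_iff hS hx hj).1 h⟩

theorem IsLarge.pointHasLabel_iff [Finite A] [DiscreteTopology A] (hk : IsLarge θ p k)
    (hθ : IsUniformlyPrimitive θ) (haper : IsAperiodic θ) (hS : IsBoundedSpeedup (shift θ) S p)
    (he : IsEntryList θ p k e) (hx : x ∈ base θ k i) (hj : j < height θ k i) :
    PointHasLabel θ S p k ((shift θ)^[j] x) ℓ ↔ Reaches (shift θ) p x (e ℓ) j := by
  refine ⟨?_, fun h => ⟨i, j, ⟨x, hx, rfl⟩, (hk.hasLabel_iff haper hS he hx).2 ⟨hj, h⟩⟩⟩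
  rintro ⟨i', j', hfloor, hlabel⟩
  obtain ⟨x', hx', -⟩ := id hfloor
  have hj' := ((hk.hasLabel_iff haper hS he hx').1 hlabel).1
  obtain ⟨rfl, rfl⟩ := floor_unique hθ haper hfloor hj' ⟨x, hx, rfl⟩ hj
  exact ((hk.hasLabel_iff haper hS he hx).1 hlabel).2

end Labels

section Transfers

variable {A : Type*} [TopologicalSpace A] {θ : A → List A} {S : subshift θ ≃ₜ subshift θ}
  {p : subshift θ → ℕ} {c k m : ℕ} {e : Fin c → ℕ} {i : A} {x : subshift θ} {ℓ : Fin c}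
  {π : A → Fin c → Fin c}

/-- The `S`-path that enters column `i` of level `k` as number `ℓ` enters the next column as number
`π i ℓ`. This describes `π^(k)` without reference to the floors inside the column. -/
def Transfers (θ : A → List A) (p : subshift θ → ℕ) (e : Fin c → ℕ) (k : ℕ)
    (π : A → Fin c → Fin c) : Prop :=
  ∀ i, ∀ x ∈ base θ k i, ∀ ℓ, Reaches (shift θ) p x (e ℓ) (e (π i ℓ) + height θ k i)

theorem IsLarge.exists_isGreatest (hk : IsLarge θ p k) (haper : IsAperiodic θ)
    (hS : IsBoundedSpeedup (shift θ) S p) (he : IsEntryList θ p k e) (hx : x ∈ base θ k i)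
    (ℓ : Fin c) : ∃ j q, IsGreatest {t | HasLabel θ S p k i ℓ t} j ∧ j < height θ k i ∧
      Reaches (shift θ) p x (e ℓ) j ∧ jumpPos (shift θ) p x j = e q + height θ k i := by
  simp only [hk.hasLabel_iff haper hS he hx]
  obtain ⟨j, ⟨hj, hreach⟩, hmax⟩ := BddAbove.exists_isGreatest_of_nonempty
    (S := {t | t < height θ k i ∧ Reaches (shift θ) p x (e ℓ) t})
    ⟨height θ k i, fun t ht => ht.1.le⟩ ⟨e ℓ, he.lt_height hk hS hx ℓ, .refl _ _ _ _⟩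
  have hleave : height θ k i ≤ jumpPos (shift θ) p x j := by
    by_contra! hlt
    exact (hmax ⟨hlt, hreach.trans (reaches_jumpPos _ _ _ _)⟩).not_gt (hS.lt_jumpPos x j)
  obtain ⟨n, hn⟩ := Nat.exists_eq_add_of_le' hleave
  obtain ⟨i', hx'⟩ := exists_shift_iterate_height_mem_base hx
  obtain ⟨q, rfl⟩ := he.exists_eq hx' (hS.mem_entries_iterate haper hj hn)
  exact ⟨j, q, ⟨⟨hj, hreach⟩, hmax⟩, hj, hreach, hn⟩

theorem IsLarge.exists_transfers (hk : IsLarge θ p k) (haper : IsAperiodic θ)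
    (hS : IsBoundedSpeedup (shift θ) S p) (he : IsEntryList θ p k e) :
    ∃ π, Transfers θ p e k π := by
  have hcol : ∀ i ℓ, ∃ q, ∀ x ∈ base θ k i,
      Reaches (shift θ) p x (e ℓ) (e q + height θ k i) := by
    intro i ℓ
    rcases (base θ k i).eq_empty_or_nonempty with hempty | ⟨b, hb⟩
    · exact ⟨ℓ, by simp [hempty]⟩
    obtain ⟨j, q, -, hj, hreach, hjump⟩ := hk.exists_isGreatest haper hS he hb ℓ
    refine ⟨q, fun x hx => ?_⟩
    rw [← hjump, ← hk.jumpPos_eq hx hb hj]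
    exact (hk.reaches_of_reaches hS hb hx hj hreach).trans (reaches_jumpPos _ _ _ _)
  choose π hπ using hcol
  exact ⟨π, fun i x hx ℓ => hπ i ℓ x hx⟩

theorem Transfers.unique [Finite A] (h : Transfers θ p e k π) (hθ : IsUniformlyPrimitive θ)
    (hne : (subshift θ).Nonempty) (he : IsEntryList θ p k e) {π' : A → Fin c → Fin c}
    (h' : Transfers θ p e k π') : π = π' := by
  ext i ℓ : 2
  obtain ⟨x, hx⟩ := base_nonempty hθ hne k i
  obtain ⟨i', hx'⟩ := exists_shift_iterate_height_mem_base hx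
  exact he.eq_of_reaches_add hx' (h i x hx ℓ) (h' i x hx ℓ)

theorem IsLarge.isLabelMap_iff [Finite A] [DiscreteTopology A] (hk : IsLarge θ p k)
    (hθ : IsUniformlyPrimitive θ) (haper : IsAperiodic θ) (hS : IsBoundedSpeedup (shift θ) S p)
    (he : IsEntryList θ p k e) : IsLabelMap θ S p k π ↔ Transfers θ p e k π := by
  have hlabel : ∀ {i x j q ℓ}, x ∈ base θ k i →
      jumpPos (shift θ) p x j = e q + height θ k i →
      (PointHasLabel θ S p k (S ((shift θ)^[j] x)) (ℓ : Fin c) ↔ ℓ = q) := by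
    intro i x j q ℓ hx hjump
    obtain ⟨i', hx'⟩ := exists_shift_iterate_height_mem_base hx
    rw [hS.apply_iterate, hjump, Function.iterate_add_apply,
      hk.pointHasLabel_iff hθ haper hS he hx' (he.lt_height hk hS hx' q)]
    exact ⟨he.eq_of_reaches_entry hx', fun h => h ▸ .refl _ _ _ _⟩
  refine ⟨fun h i x hx ℓ => ?_, fun h i ℓ j hj => ?_⟩
  · obtain ⟨j, q, hj, -, hreach, hjump⟩ := hk.exists_isGreatest haper hS he hx ℓ
    rw [(hlabel hx hjump).1 (h i ℓ j hj _ ⟨x, hx, rfl⟩), ← hjump]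
    exact hreach.trans (reaches_jumpPos _ _ _ _)
  · rintro _ ⟨x, hx, rfl⟩
    obtain ⟨j', q, hj', -, hreach, hjump⟩ := hk.exists_isGreatest haper hS he hx ℓ
    obtain rfl := hj.unique hj'
    obtain ⟨i', hx'⟩ := exists_shift_iterate_height_mem_base hx
    exact (hlabel hx hjump).2 (he.eq_of_reaches_add hx' (h i x hx ℓ)
      (hjump ▸ hreach.trans (reaches_jumpPos _ _ _ _)))

theorem Transfers.reaches_of_iter_eq_append (h : Transfers θ p e k π) (hθ : IsNonerasing θ)
    (hx : x ∈ base θ (k + m) i) {u v : List A} (hi : iter θ m i = u ++ v) (ℓ : Fin c) :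
    Reaches (shift θ) p x (e ℓ) (e (u.foldl (flip π) ℓ) + (u.flatMap (iter θ k)).length) := by
  induction u using List.reverseRecOn generalizing v with
  | nil => exact .refl _ _ _ _
  | append_singleton u a ih =>
    rw [List.append_assoc, List.singleton_append] at hi
    have hstep := reaches_iterate_iff.1
      (h a _ (shift_iterate_mem_base_of_add hθ hx hi) (u.foldl (flip π) ℓ))
    rw [List.foldl_append, List.flatMap_append, List.length_append, List.flatMap_singleton,
      add_comm (u.flatMap _).length, ← add_assoc]
    exact (ih hi).trans hstep

theorem Transfers.add (h : Transfers θ p e k π) (hθ : IsNonerasing θ) (m : ℕ) :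
    Transfers θ p e (k + m) fun i ℓ => (iter θ m i).foldl (flip π) ℓ := fun i x hx ℓ => by
  rw [height, iter_add]
  exact h.reaches_of_iter_eq_append hθ hx (v := []) (by simp) ℓ

end Transfers

section StableLevels

theorem exists_iterate_mul_sub_eq {β : Type*} [Finite β] (f : β → β) (b : β) (k : ℕ) :
    ∃ K, k < K ∧ ∀ j, 1 ≤ j → f^[j * K - k] b = f^[K - k] b := by
  obtain ⟨n, t, ht, hper⟩ : ∃ n t, 0 < t ∧ Function.IsPeriodicPt f t (f^[n] b) := by
    obtain ⟨n, n', hlt, heq⟩ := Set.finite_univ.exists_lt_map_eq_of_forall_mem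
      (f := fun n => f^[n] b) fun _ => Set.mem_univ _
    refine ⟨n, n' - n, Nat.sub_pos_of_lt hlt, ?_⟩
    rw [Function.IsPeriodicPt, Function.IsFixedPt, ← Function.iterate_add_apply,
      Nat.sub_add_cancel hlt.le]
    exact heq.symm
  have hK : k + n + 1 ≤ (k + n + 1) * t := Nat.le_mul_of_pos_right _ ht
  refine ⟨(k + n + 1) * t, by omega, fun j hj => ?_⟩
  obtain ⟨d, hd⟩ := Nat.exists_eq_add_of_le (show n ≤ (k + n + 1) * t - k by omega)
  obtain ⟨j, rfl⟩ := Nat.exists_eq_add_of_le' hj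
  have hperd : Function.IsPeriodicPt f t (f^[(k + n + 1) * t - k] b) := by
    rw [hd, add_comm, Function.iterate_add_apply]
    exact hper.apply_iterate d
  rw [add_one_mul, Nat.add_sub_assoc (by omega), Function.iterate_add_apply, ← mul_assoc]
  exact hperd.const_mul _

variable {A : Type*} [TopologicalSpace A] {θ : A → List A} {S : subshift θ ≃ₜ subshift θ}
  {p : subshift θ → ℕ} {c k K : ℕ} {e : Fin c → ℕ} {π : A → Fin c → Fin c}

theorem IsStableLevel.isLarge_mul (hK : IsStableLevel θ S p K π) (hθ : IsNonerasing θ) {j : ℕ}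
    (hj : 1 ≤ j) : IsLarge θ p (j * K) := by
  obtain ⟨j, rfl⟩ := Nat.exists_eq_add_of_le hj
  rw [add_mul, one_mul]
  exact hK.large.add hθ _

theorem IsEntryList.mul (he : IsEntryList θ p K e) (hθ : IsNonerasing θ) {j : ℕ} (hj : 1 ≤ j) :
    IsEntryList θ p (j * K) e := by
  obtain ⟨j, rfl⟩ := Nat.exists_eq_add_of_le hj
  rw [add_mul, one_mul]
  exact he.add hθ _

variable [Finite A] [DiscreteTopology A]

theorem IsLarge.exists_isStableLevel (hk : IsLarge θ p k) (hθ : IsUniformlyPrimitive θ)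
    (haper : IsAperiodic θ) (hS : IsBoundedSpeedup (shift θ) S p) (he : IsEntryList θ p k e) :
    ∃ (K : ℕ) (π : A → Fin c → Fin c), IsStableLevel θ S p K π := by
  let Φ (π : A → Fin c → Fin c) (i : A) (ℓ : Fin c) : Fin c := (iter θ 1 i).foldl (flip π) ℓ
  obtain ⟨π₀, hπ₀⟩ := hk.exists_transfers haper hS he
  have htransfers : ∀ m, Transfers θ p e (k + m) (Φ^[m] π₀) := fun m => by
    induction m with
    | zero => exact hπ₀
    | succ m ih =>
      rw [Function.iterate_succ_apply']
      exact ih.add hθ.isNonerasing 1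
  obtain ⟨K, hkK, hΦ⟩ := exists_iterate_mul_sub_eq Φ π₀ k
  have hlevel : ∀ j, 1 ≤ j → k + (j * K - k) = j * K := fun j hj =>
    Nat.add_sub_cancel' (hkK.le.trans (Nat.le_mul_of_pos_left K hj))
  refine ⟨K, Φ^[K - k] π₀, by omega, ?_, fun j hj => ?_⟩
  · rw [← Nat.add_sub_cancel' hkK.le]
    exact hk.add hθ.isNonerasing _
  · rw [← hlevel j hj, (hk.add hθ.isNonerasing _).isLabelMap_iff hθ haper hS
      (he.add hθ.isNonerasing _), ← hΦ j hj]
    exact htransfers _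

theorem IsStableLevel.transfers (hK : IsStableLevel θ S p K π) (hθ : IsUniformlyPrimitive θ)
    (haper : IsAperiodic θ) (hS : IsBoundedSpeedup (shift θ) S p) (he : IsEntryList θ p K e)
    {j : ℕ} (hj : 1 ≤ j) : Transfers θ p e (j * K) π :=
  ((hK.isLarge_mul hθ.isNonerasing hj).isLabelMap_iff hθ haper hS
    (he.mul hθ.isNonerasing hj)).1 (hK.labelMap j hj)

theorem IsStableLevel.foldl_iter (hK : IsStableLevel θ S p K π) (hθ : IsUniformlyPrimitive θ)
    (hne : (subshift θ).Nonempty) (haper : IsAperiodic θ) (hS : IsBoundedSpeedup (shift θ) S p)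
    (he : IsEntryList θ p K e) (i : A) (ℓ : Fin c) :
    (iter θ K i).foldl (flip π) ℓ = π i ℓ := by
  have htransfers : Transfers θ p e (K + K) π := two_mul K ▸ hK.transfers hθ haper hS he one_le_two
  have hsquare := (one_mul K ▸ hK.transfers hθ haper hS he le_rfl).add hθ.isNonerasing K
  exact congrFun₂ (hsquare.unique hθ hne (he.add hθ.isNonerasing K) htransfers) i ℓ

end StableLevels

section LabelWords

variable {A C : Type*} {π : A → C → C} {ℓ : C} {w : List A} {q : A × C}

theorem labelWord_append (π : A → C → C) (ℓ : C) (u v : List A) :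
    labelWord π ℓ (u ++ v) = labelWord π ℓ u ++ labelWord π (u.foldl (flip π) ℓ) v := by
  induction u generalizing ℓ with
  | nil => rfl
  | cons a u ih => exact congrArg (List.cons (a, ℓ)) (ih (π a ℓ))

@[simp]
theorem length_labelWord (π : A → C → C) (ℓ : C) (w : List A) :
    (labelWord π ℓ w).length = w.length := by
  induction w generalizing ℓ with
  | nil => rfl
  | cons a w ih => simp [labelWord, ih]

theorem mem_labelWord_iff :
    q ∈ labelWord π ℓ w ↔ ∃ u v, w = u ++ q.1 :: v ∧ u.foldl (flip π) ℓ = q.2 := by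
  constructor
  · intro h
    induction w generalizing ℓ with
    | nil => simp [labelWord] at h
    | cons a w ih =>
      rcases List.mem_cons.1 h with rfl | h
      · exact ⟨[], w, rfl, rfl⟩
      · obtain ⟨u, v, rfl, hfold⟩ := ih h
        exact ⟨a :: u, v, rfl, hfold⟩
  · rintro ⟨u, v, rfl, h⟩
    rw [labelWord_append, h]
    exact List.mem_append_right _ List.mem_cons_self

variable {θ : A → List A} {K : ℕ}

theorem extend_symbolLabel_labelWord (h : ∀ i ℓ, (iter θ K i).foldl (flip π) ℓ = π i ℓ) (ℓ : C)
    (w : List A) : extend (symbolLabel θ K π) (labelWord π ℓ w)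
      = labelWord π ℓ (w.flatMap (iter θ K)) := by
  induction w generalizing ℓ with
  | nil => rfl
  | cons a w ih =>
    rw [List.flatMap_cons, labelWord_append, h, ← ih]
    rfl

theorem iter_symbolLabel (h : ∀ i ℓ, (iter θ K i).foldl (flip π) ℓ = π i ℓ) (n : ℕ)
    (q : A × C) : iter (symbolLabel θ K π) n q = labelWord π q.2 (iter θ (n * K) q.1) := by
  induction n with
  | zero => rw [zero_mul]; rfl
  | succ n ih =>
    rw [iter, Function.iterate_succ_apply', ← iter, ih, extend_symbolLabel_labelWord h,
      ← iter_add, add_one_mul, add_comm]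

theorem length_iter_symbolLabel_tendsto (hθ : IsPrimitive θ) (hK : 0 < K)
    (h : ∀ i ℓ, (iter θ K i).foldl (flip π) ℓ = π i ℓ) (q : A × C) :
    Filter.Tendsto (fun n => (iter (symbolLabel θ K π) n q).length) Filter.atTop
      Filter.atTop := by
  simp only [iter_symbolLabel h, length_labelWord]
  exact (hθ.length_tendsto q.1).comp (Filter.tendsto_id.atTop_mul_const' hK)

theorem isUniformlyPrimitive_symbolLabel [Finite A] [Finite C] (hθ : IsNonerasing θ)
    (hp : IsProper θ) (hK : 0 < K) (h : ∀ i ℓ, (iter θ K i).foldl (flip π) ℓ = π i ℓ)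
    (hprim : IsPrimitive (symbolLabel θ K π)) : IsUniformlyPrimitive (symbolLabel θ K π) := by
  obtain ⟨l, _, k₀, hlr⟩ := hp
  refine isUniformlyPrimitive_of_forall_mem_iter hprim.mem_iter (fun q => (l, q.2)) k₀
    fun n hn q => ?_
  obtain ⟨w, hw⟩ := List.head?_eq_some_iff.1
    (hθ.head?_iter (fun a => (hlr a).1) (hn.trans (Nat.le_mul_of_pos_right n hK)) q.1)
  rw [iter_symbolLabel h, mem_labelWord_iff]
  exact ⟨[], w, hw, rfl⟩

end LabelWords

section Minimality

variable {A : Type*} [TopologicalSpace A] {θ : A → List A} {S : subshift θ ≃ₜ subshift θ}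
  {p : subshift θ → ℕ} {c k m K t : ℕ} {e : Fin c → ℕ} {i i' : A} {x : subshift θ}
  {ℓ ℓ' : Fin c} {π : A → Fin c → Fin c}

theorem Transfers.exists_reaches_of_mem_labelWord (h : Transfers θ p e k π)
    (hθ : IsNonerasing θ) (hx : x ∈ base θ (k + m) i)
    (hmem : (i', ℓ') ∈ labelWord π ℓ (iter θ m i)) :
    ∃ d, (shift θ)^[d] x ∈ base θ k i' ∧ Reaches (shift θ) p x (e ℓ) (e ℓ' + d) := by
  obtain ⟨u, v, hi, rfl⟩ := mem_labelWord_iff.1 hmem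
  exact ⟨_, shift_iterate_mem_base_of_add hθ hx hi, h.reaches_of_iter_eq_append hθ hx hi ℓ⟩

theorem Transfers.mem_labelWord_of_reaches [Finite A] (h : Transfers θ p e k π)
    (hθ : IsUniformlyPrimitive θ) (haper : IsAperiodic θ) (he : IsEntryList θ p k e)
    (hx : x ∈ base θ (k + m) i) (ht : t < height θ (k + m) i)
    (hreach : Reaches (shift θ) p x (e ℓ) t) (hlow : e ℓ' < height θ k i')
    (hfloor : (shift θ)^[t] x ∈ floor θ k i' (e ℓ')) :
    (i', ℓ') ∈ labelWord π ℓ (iter θ m i) := by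
  rw [height, iter_add] at ht
  obtain ⟨u, a, v, hi, hle, hlt⟩ := exists_split_flatMap ht
  obtain ⟨j, rfl⟩ := Nat.exists_eq_add_of_le' hle
  have ha := shift_iterate_mem_base_of_add hθ.isNonerasing hx hi
  rw [Function.iterate_add_apply] at hfloor
  obtain ⟨rfl, rfl⟩ := floor_unique hθ haper ⟨_, ha, rfl⟩ (by rw [height]; omega) hfloor hlow
  exact mem_labelWord_iff.2 ⟨u, v, hi, he.eq_of_reaches_add ha
    (h.reaches_of_iter_eq_append hθ.isNonerasing hx hi ℓ) hreach⟩

variable [Finite A] [DiscreteTopology A]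

theorem IsLarge.isPrimitive_symbolLabel_of_isMinimal (hk : IsLarge θ p K) (hprim : IsPrimitive θ)
    (hθ : IsUniformlyPrimitive θ) (hne : (subshift θ).Nonempty) (haper : IsAperiodic θ)
    (hS : IsBoundedSpeedup (shift θ) S p) (hK : 0 < K) (he : IsEntryList θ p K e)
    (hπ : Transfers θ p e K π) (hfold : ∀ i ℓ, (iter θ K i).foldl (flip π) ℓ = π i ℓ)
    (hmin : IsMinimalHomeo S) : IsPrimitive (symbolLabel θ K π) := by
  refine ⟨?_, length_iter_symbolLabel_tendsto hprim hK hfold⟩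
  rintro ⟨i, ℓ⟩ ⟨i', ℓ'⟩
  have := compactSpace_subshift θ
  obtain ⟨b, hb⟩ := base_nonempty hθ hne K i'
  have hlow : e ℓ' < height θ K i' := he.lt_height hk hS hb ℓ'
  obtain ⟨N, hN⟩ := hmin.exists_return_time (isOpen_floor hθ haper hlow) ⟨_, b, hb, rfl⟩
  have hheight : Filter.Tendsto (fun n => height θ (K + n * K) i) Filter.atTop Filter.atTop :=
    (hprim.length_tendsto i).comp (Filter.tendsto_atTop_mono (fun n => Nat.le_add_left (n * K) K)
      (Filter.tendsto_id.atTop_mul_const' hK))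
  obtain ⟨n, hn⟩ := (hheight.eventually_gt_atTop (e ℓ + N * maxJump p)).exists
  obtain ⟨x, hx⟩ := base_nonempty hθ hne (K + n * K) i
  obtain ⟨s, hs, hmem⟩ := hN ((shift θ)^[e ℓ] x)
  rw [hS.iterate_iterate] at hmem
  have hlt : (jumpPos (shift θ) p x)^[s] (e ℓ) < height θ (K + n * K) i :=
    (hS.iterate_jumpPos_le x s _).trans_lt (hn.trans_le' (by gcongr))
  refine ⟨n, ?_⟩
  rw [iter_symbolLabel hfold]
  exact hπ.mem_labelWord_of_reaches hθ haper he hx hlt ⟨s, rfl⟩ hlow hmem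

theorem IsStableLevel.isMinimal_of_isPrimitive_symbolLabel (hK : IsStableLevel θ S p K π)
    (hprim : IsPrimitive θ) (hproper : IsProper θ) (haper : IsAperiodic θ)
    (hS : IsBoundedSpeedup (shift θ) S p) (he : IsEntryList θ p K e)
    (hfold : ∀ i ℓ, (iter θ K i).foldl (flip π) ℓ = π i ℓ)
    (hσ : IsPrimitive (symbolLabel θ K π)) : IsMinimalHomeo S := by
  have hθ := hprim.isUniformlyPrimitive hproper
  have hne := hprim.isNonerasing
  obtain ⟨n, hn⟩ := isUniformlyPrimitive_symbolLabel hne hproper hK.pos hfold hσ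
  intro x
  rw [dense_iff_inter_open]
  intro U hU hUne
  obtain ⟨k₀, hk₀⟩ := exists_floor_subset hprim hproper hU hUne
  have hlevel : 1 ≤ k₀ + 1 := Nat.le_add_left 1 k₀
  obtain ⟨i', j', hj', hfloor⟩ := hk₀ ((k₀ + 1) * K)
    ((Nat.le_succ k₀).trans (Nat.le_mul_of_pos_right _ hK.pos))
  have he' := he.mul hne hlevel
  obtain ⟨i, y, hy, ℓ, hyx⟩ := (he'.add hne (n * K)).exists_orbit_eq hθ hS x
  obtain ⟨b, hb⟩ := base_nonempty hθ ⟨_, x.2⟩ ((k₀ + 1) * K) i'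
  obtain ⟨q, hq⟩ := he'.exists_reaches hS hb j'
  have hmem := hn n le_rfl (i, ℓ) (i', q)
  rw [iter_symbolLabel hfold] at hmem
  obtain ⟨d, hd, hreach⟩ := (hK.transfers hθ haper hS he
    hlevel).exists_reaches_of_mem_labelWord hne hy hmem
  have hclimb : Reaches (shift θ) p y (e q + d) (j' + d) :=
    reaches_iterate_iff.1 ((hK.isLarge_mul hne hlevel).reaches_of_reaches hS hb hd hj' hq)
  refine ⟨(shift θ)^[j' + d] y,
    hfloor ⟨_, hd, (Function.iterate_add_apply _ _ _ _).symm⟩, ?_⟩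
  rw [← hyx, hS.orbit_eq_of_reaches (hreach.trans hclimb)]
  exact mem_orbit_self S _

end Minimality

end Speedup

theorem mainTheorem9 {A : Type*} [Finite A] [TopologicalSpace A] [DiscreteTopology A]
    (θ : A → List A) (hproper : Speedup.IsProper θ) (hprim : Speedup.IsPrimitive θ)
    (haper : Speedup.IsAperiodic θ)
    (S : Speedup.subshift θ ≃ₜ Speedup.subshift θ) (p : Speedup.subshift θ → ℕ)
    (hS : Speedup.IsBoundedSpeedup (Speedup.shift θ) S p) :
    ∃ c : ℕ, 0 < c ∧ Speedup.IsOrbitNumber (Speedup.shift θ) S c ∧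
      (∃ (K : ℕ) (π : A → Fin c → Fin c), Speedup.IsStableLevel θ S p K π) ∧
      ∀ (K : ℕ) (π : A → Fin c → Fin c), Speedup.IsStableLevel θ S p K π →
        (Speedup.IsPrimitive (Speedup.symbolLabel θ K π) ↔ Speedup.IsMinimalHomeo S) := by
  open Speedup in
  have hθ := hprim.isUniformlyPrimitive hproper
  have : Nonempty A := ⟨hproper.choose⟩
  have hne := hprim.subshift_nonempty
  have hbase : ∀ k, ∃ b, b ∈ ⋃ i, base θ k i := fun k =>
    (base_nonempty hθ hne k hproper.choose).imp fun _ => Set.mem_iUnion_of_mem _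
  obtain ⟨k, hk⟩ := exists_isLarge hprim hproper (hS.continuous_jump haper)
  obtain ⟨b, hb⟩ := hbase k
  have hk := hk k le_rfl
  have hfin := hS.finite_entries b
  have hc := hfin.cast_ncard_eq.symm
  have horbits := (hk.isOrbitNumber_iff hθ haper hS hb _).2 hc
  refine ⟨_, (Set.ncard_pos hfin).2 ⟨0, hS.zero_mem_entries b⟩, horbits, ?_, fun K π hK => ?_⟩
  · obtain ⟨e, he⟩ := hk.exists_isEntryList hS hb hc
    exact hk.exists_isStableLevel hθ haper hS he
  · obtain ⟨b', hb'⟩ := hbase K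
    obtain ⟨e, he⟩ := hK.large.exists_isEntryList hS hb'
      ((hK.large.isOrbitNumber_iff hθ haper hS hb' _).1 horbits)
    have hfold := hK.foldl_iter hθ hne haper hS he
    exact ⟨hK.isMinimal_of_isPrimitive_symbolLabel hprim hproper haper hS he hfold,
      hK.large.isPrimitive_symbolLabel_of_isMinimal hprim hθ hne haper hS hK.pos he
        (one_mul K ▸ hK.transfers hθ haper hS he le_rfl) hfold⟩
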